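/- Let $H$ be a real Hilbert space and let $A:D(A)\subset H\to H$ be closed, densely defined, self-adjoint and positive definite with compact resolvent. Let $(\phi_n)_{n\ge1}\subset D(A)$ be an orthonormal basis of $H$ with $A\phi_n=\lambda_n\phi_n$, $\lambda_1\le\lambda_2\le\cdots$. Let $U$ be a real Hilbert space and $B:U\to H$ bounded and linear; elements of $D(A)$ are regarded as elements of $U$ by means of a linear map $\iota:D(A)\to U$ (the inclusion, if $D(A)\subset U$), which is suppressed in the notation. Let $\delta>0$, $\beta(t)=e^{-\delta t}$ and $0<\gamma<1+\delta$. Put $$\mu_n^\pm=\tfrac12\Big(\lambda_n+\delta\pm\sqrt{(\lambda_n-\delta)^2-4\lambda_n}\Big)\in\mathbb C,$$ let $N$ be the largest $n$ with $\operatorname{Re}\mu_n^+\le\gamma$ or $\operatorname{Re}\mu_n^-\le\gamma$ ($N=0$ if there is none), let $m(\lambda)=\#\{j\le N:\lambda_j=\lambda\}$ and let $M=\max_{j\le N}m(\lambda_j)$ ($M=0$ if $N=0$). Consider the complex matrices $$P=\begin{pmatrix}0&I_N\\-\operatorname{diag}(\lambda_j(1+\delta))&-\operatorname{diag}(\lambda_j+\delta)\end{pmatrix},\qquad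 Q=\begin{pmatrix}0\\C_{NM}\end{pmatrix},\qquad C_{NM}=\big((B\phi_i,\phi_j)\big)_{j\le N,\;i\le M}.$$ Rank assumption: there are an invertible complex $2N\times2N$ matrix $R$ and a matrix $J$ with diagonal $(-\mu_1^+,\dots,-\mu_N^+,-\mu_1^-,\dots,-\mu_N^-)$ such that $P=R^{-1}JR$, where $J$ is diagonal (semisimple eigenvalues) or, for some ordering of its index set, a Jordan matrix (general case), and such that for each $\lambda\in\{\lambda_1,\dots,\lambda_N\}$ the submatrix of $(RQ)^*$ formed by the columns $j\le N$ with $\lambda_j=\lambda$, and likewise the one formed by the columns $N+j$ with $j\le N$, $\lambda_j=\lambda$, has rank $m(\lambda)$. Let $f:[0,\infty)\to H$ belong to $H^1((0,T);H)$ for all $T>0$, with $f(t)\in\operatorname{Range}(B)$ for all $t\ge0$ and $f(t)\to f_e\in\operatorname{Range}(B)$ as $t\to\infty$; let $y_e\in D(A)$ satisfy $(1+\frac1\delta)Ay_e=f_e$, let $g(t)=\frac1\delta e^{-\delta t}Ay_e$, and let $y_0\in H$. Consider the control system translated around $y_e$, $$y'(t)+Ay(t)+\int_0^t\beta(t-s)Ay(s)\,ds=g(t)+f(t)-f_e+B\tilde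 u(t)\quad(t>0),\qquad y(0)=y_0-y_e. \tag{1}$$ A solution of (1) is a function $y\in C([0,\infty);H)\cap C^1((0,\infty);H)$ with this initial value such that, for all $t>0$, $y(t)$ and $\int_0^t\beta(t-s)y(s)\,ds$ are in $D(A)$ and the equation holds, its memory term being read as $A\int_0^t\beta(t-s)y(s)\,ds$. It is classical if $y\in C^1([0,\infty);H)\cap C([0,\infty);D(A))$ and the equation holds as written for all $t\ge0$. For $v=(v_1,\dots,v_M):[0,\infty)\to\mathbb R^M$ put $u(t)=\sum_{i=1}^M v_i(t)\phi_i$, and let $\tilde u:[0,\infty)\to U$ be obtained from $u$ by absorbing the forcing: $$u(t)=\tilde u(t)+\tilde f(t)-\Big(1-\frac{e^{-\delta t}}{1+\delta}\Big)\tilde f_e,\qquad B\tilde f(t)=f(t),\quad B\tilde f_e=f_e .$$ Say that $v$ stabilizes (1) with constant $C$ if such $\tilde u$ exist and, for every such $\tilde u$, system (1) has exactly one solution $y$ on $[0,\infty)$, this $y$ is classical if $y_0\in D(A)$, and $$|y(t)|\le Ce^{-\gamma t}|y_0-y_e|\qquad(t\ge0).$$ Then: (a) For every $T>0$ there is $C>0$,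 independent of $f$, $f_e$, $y_e$, $y_0$, such that for all such data there are $v\in C([0,\infty);\mathbb R^M)$ and $w:[0,\infty)\to\mathbb R^M$, continuous on $[0,T]$, such that $v$ stabilizes (1) with constant $C$ and $$v_i(t)=-\int_t^T\beta(t-s)w_i(s)\,ds\ \ (0\le t<T),\qquad v_i(t)=w_i(t)=0\ \ (t\ge T),\qquad \int_0^T\sum_{i=1}^M|w_i(t)|^2\,dt\le C|y_0-y_e|^2 .$$ (b) There is $C>0$, independent of $f$, $f_e$, $y_e$, $y_0$, such that for all such data there is $v\in C^2([0,\infty);\mathbb R^M)$ that stabilizes (1) with constant $C$ and satisfies $$|v_j(t)|+|v_j'(t)|+|v_j''(t)|\le Ce^{-\gamma t}|y_0-y_e|\qquad(t>0,\ j=1,\dots,M).$$ -/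

import Mathlib

open Set Filter Topology MeasureTheory

namespace PIDE

noncomputable section

variable {H U : Type*} [NormedAddCommGroup H] [InnerProductSpace ℝ H] [CompleteSpace H]
  [NormedAddCommGroup U] [InnerProductSpace ℝ U]

/-! ### The operator and its eigenfunctions -/

/-- `A` is closed, densely defined, self-adjoint, positive definite, and
`(r I - A)⁻¹` is a compact operator on `H` for some `r` in the resolvent set. -/
structure IsAdmissibleOperator (A : H →ₗ.[ℝ] H) : Prop where
  closed : A.IsClosed
  dense : Dense (A.domain : Set H)
  selfAdjoint : IsSelfAdjoint A
  posDef : ∀ x : A.domain, x ≠ 0 → 0 < inner ℝ (A x) (x : H)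
  compactResolvent : ∃ (r : ℝ) (K : H →L[ℝ] H), IsCompactOperator K ∧
    (∀ x : A.domain, K (r • (x : H) - A x) = x) ∧
    (∀ z : H, ∃ x : A.domain, (x : H) = K z ∧ r • (x : H) - A x = z)

/-- `φ 0, φ 1, …` is an orthonormal basis of `H` that consists of eigenfunctions of `A`, the
eigenvalues `lam 0 ≤ lam 1 ≤ …` being repeated according to multiplicity. -/
structure IsEigenbasis (A : H →ₗ.[ℝ] H) (φ : ℕ → A.domain) (lam : ℕ → ℝ) : Prop where
  orthonormal : Orthonormal ℝ (fun n => (φ n : H))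
  complete : (Submodule.span ℝ (range fun n => (φ n : H))).topologicalClosure = ⊤
  eigen : ∀ n, A (φ n) = lam n • (φ n : H)
  mono : Monotone lam

/-! ### The kernel -/

/-- The kernel `β(t) = e^{-δ t}`. -/
def beta (δ t : ℝ) : ℝ := Real.exp (-δ * t)

theorem beta_zero (δ : ℝ) : beta δ 0 = 1 := by simp [beta]

/-- `β' + δ β = 0`. -/
theorem hasDerivAt_beta (δ t : ℝ) : HasDerivAt (beta δ) (-δ * beta δ t) t := by
  have h := ((hasDerivAt_id t).const_mul (-δ)).exp
  simp only [id, mul_one] at h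
  rw [mul_comm] at h
  exact h

/-! ### Unstable modes -/

/-- The square root of the (real) discriminant, as a complex number. -/
def sqrtDisc (δ l : ℝ) : ℂ := (((l - δ) ^ 2 - 4 * l : ℝ) : ℂ) ^ ((2 : ℂ)⁻¹)

/-- `μ⁺ = (l + δ + √((l - δ)² - 4 l)) / 2`. -/
def muPlus (δ l : ℝ) : ℂ := ((l + δ : ℝ) + sqrtDisc δ l) / 2

/-- `μ⁻ = (l + δ - √((l - δ)² - 4 l)) / 2`. -/
def muMinus (δ l : ℝ) : ℂ := ((l + δ : ℝ) - sqrtDisc δ l) / 2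

/-- `N = max N₁ N₂`, where `N₁` and `N₂` are the largest positions (counted from one) at which
`Re μ⁺ ≤ γ`, respectively `Re μ⁻ ≤ γ`; it is zero if there is no such position. Eigenvalues are
indexed from zero, so `lam j` stands at position `j + 1`. -/
def numUnstable (δ γ : ℝ) (lam : ℕ → ℝ) : ℕ :=
  max (sSup {n | ∃ j, n = j + 1 ∧ (muPlus δ (lam j)).re ≤ γ})
    (sSup {n | ∃ j, n = j + 1 ∧ (muMinus δ (lam j)).re ≤ γ})

open Classical in
/-- The multiplicity of `l` among `lam 0, …, lam (N - 1)`. -/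
def mult (lam : ℕ → ℝ) (N : ℕ) (l : ℝ) : ℕ := {j ∈ Finset.range N | lam j = l}.card

/-- `M`, the largest multiplicity of the eigenvalues `lam 0, …, lam (N - 1)`. -/
def maxMult (lam : ℕ → ℝ) (N : ℕ) : ℕ := (Finset.range N).sup fun j => mult lam N (lam j)

/-! ### The matrices of the unstable part and the rank assumptions -/

/-- The `N × M` matrix with entry `(B φ_i, φ_j)` in row `j` and column `i`. The map `ι` regards
elements of `D(A)` as elements of the control space. -/
def matC (A : H →ₗ.[ℝ] H) (B : U →L[ℝ] H) (ι : A.domain →ₗ[ℝ] U) (φ : ℕ → A.domain) (N M : ℕ) :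
    Matrix (Fin N) (Fin M) ℂ :=
  Matrix.of fun j i => ((inner ℝ (B (ι (φ i))) (φ j : H) : ℝ) : ℂ)

/-- `P = (0, I; -diag(λ_j (1 + δ)), -diag(λ_j + δ))`, of size `2N`. -/
def matP (δ : ℝ) (lam : ℕ → ℝ) (N : ℕ) : Matrix (Fin N ⊕ Fin N) (Fin N ⊕ Fin N) ℂ :=
  Matrix.fromBlocks 0 1
    (-Matrix.diagonal fun j : Fin N => ((lam j * (1 + δ) : ℝ) : ℂ))
    (-Matrix.diagonal fun j : Fin N => ((lam j + δ : ℝ) : ℂ))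

/-- `Q = (0; C)`, of size `2N × M`. -/
def matQ (A : H →ₗ.[ℝ] H) (B : U →L[ℝ] H) (ι : A.domain →ₗ[ℝ] U) (φ : ℕ → A.domain) (N M : ℕ) :
    Matrix (Fin N ⊕ Fin N) (Fin M) ℂ :=
  Matrix.fromRows 0 (matC A B ι φ N M)

/-- The list `-μ⁺_1, …, -μ⁺_N, -μ⁻_1, …, -μ⁻_N` of the eigenvalues of `P`. -/
def eigList (δ : ℝ) (lam : ℕ → ℝ) (N : ℕ) : Fin N ⊕ Fin N → ℂ :=
  Sum.elim (fun j => -muPlus δ (lam j)) (fun j => -muMinus δ (lam j))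

/-- For `S = R Q` and each eigenvalue `l` among `lam 0, …, lam (N - 1)`, of multiplicity `m`, the
two blocks of `m` columns of `S*` that belong to `l` (one in the first `N` columns, one in the last
`N`) have rank `m`. -/
def BlockRanks (lam : ℕ → ℝ) (N M : ℕ) (S : Matrix (Fin N ⊕ Fin N) (Fin M) ℂ) : Prop :=
  ∀ k : Fin N,
    (S.conjTranspose.submatrix id
      (fun j : {j : Fin N // lam j = lam k} => Sum.inl j.1)).rank = mult lam N (lam k) ∧
    (S.conjTranspose.submatrix id
      (fun j : {j : Fin N // lam j = lam k} => Sum.inr j.1)).rank = mult lam N (lam k)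

/-- The rank assumption for semisimple eigenvalues: `P = R⁻¹ D R` with `D` diagonal, and `R Q`
has blocks of full rank. -/
def SemisimpleRank (A : H →ₗ.[ℝ] H) (B : U →L[ℝ] H) (ι : A.domain →ₗ[ℝ] U) (φ : ℕ → A.domain)
    (lam : ℕ → ℝ) (δ : ℝ) (N M : ℕ) : Prop :=
  ∃ R : Matrix (Fin N ⊕ Fin N) (Fin N ⊕ Fin N) ℂ, IsUnit R ∧
    matP δ lam N = R⁻¹ * Matrix.diagonal (eigList δ lam N) * R ∧
    BlockRanks lam N M (R * matQ A B ι φ N M)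

/-- `J` is a Jordan matrix, for some enumeration of its index set: off the diagonal the only
nonzero entries are ones right above the diagonal, between equal diagonal entries. -/
def IsJordan {n : Type*} [Fintype n] (J : Matrix n n ℂ) : Prop :=
  ∃ e : n ≃ Fin (Fintype.card n), ∀ i j, i ≠ j → J i j ≠ 0 →
    (e j : ℕ) = (e i : ℕ) + 1 ∧ J i j = 1 ∧ J i i = J j j

/-- The rank assumption for general (non-semisimple) eigenvalues: `P = R⁻¹ J R` with a Jordan
matrix `J` whose diagonal lists the eigenvalues, and `R Q` has blocks of full rank. -/
def JordanRank (A : H →ₗ.[ℝ] H) (B : U →L[ℝ] H) (ι : A.domain →ₗ[ℝ] U) (φ : ℕ → A.domain)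
    (lam : ℕ → ℝ) (δ : ℝ) (N M : ℕ) : Prop :=
  ∃ R J : Matrix (Fin N ⊕ Fin N) (Fin N ⊕ Fin N) ℂ, IsUnit R ∧
    IsJordan J ∧ (∀ i, J i i = eigList δ lam N i) ∧
    matP δ lam N = R⁻¹ * J * R ∧
    BlockRanks lam N M (R * matQ A B ι φ N M)

/-! ### Solutions of `y' + A y + ∫₀ᵗ β(t-s) A y(s) ds = F`, `y(0) = x₀` -/

/-- Solutions for an initial value in `H`: continuous on `[0, ∞)`, continuously differentiable on
`(0, ∞)`, with the equation in `H` for all `t > 0`. As `A y` need not be Bochner integrable up to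
`0`, the memory term is written `A ∫₀ᵗ β(t-s) y(s) ds`. -/
def IsSolution (A : H →ₗ.[ℝ] H) (δ : ℝ) (F : ℝ → H) (x₀ : H) (y : ℝ → H) : Prop :=
  ContinuousOn y (Ici 0) ∧ y 0 = x₀ ∧ ContDiffOn ℝ 1 y (Ioi 0) ∧
  ∀ t > 0, ∃ a b : A.domain, (a : H) = y t ∧ (b : H) = ∫ s in (0 : ℝ)..t, beta δ (t - s) • y s ∧
    deriv y t + A a + A b = F t

/-- Classical solutions: `y ∈ C¹([0, ∞); H) ∩ C([0, ∞); D(A))`, with the equation in its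
original form for all `t ≥ 0`. Here `z = A y`. -/
def IsClassicalSolution (A : H →ₗ.[ℝ] H) (δ : ℝ) (F : ℝ → H) (x₀ : H) (y : ℝ → H) : Prop :=
  y 0 = x₀ ∧ ContDiffOn ℝ 1 y (Ici 0) ∧
  ∃ z : ℝ → H, ContinuousOn z (Ici 0) ∧ ∀ t ≥ 0, (y t, z t) ∈ A.graph ∧
    derivWithin y (Ici 0) t + z t + ∫ s in (0 : ℝ)..t, beta δ (t - s) • z s = F t

/-! ### The forced system, translated around its equilibrium -/

/-- `f ∈ H¹((0, T); H)` for all `T > 0` (`f` being the continuous representative), with values in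
the range of `B`; it tends to `fe`, which is in the range of `B` too; and `ye` is the equilibrium,
`(1 + 1/δ) A ye = fe`. -/
structure IsForcing (A : H →ₗ.[ℝ] H) (B : U →L[ℝ] H) (δ : ℝ) (f : ℝ → H) (fe : H)
    (ye : A.domain) : Prop where
  sobolev : ∃ f' : ℝ → H, (∀ T > 0, MemLp f' 2 (volume.restrict (Ioc 0 T))) ∧
    ∀ t ≥ 0, f t = f 0 + ∫ s in (0 : ℝ)..t, f' s
  mem_range : ∀ t ≥ 0, f t ∈ range B
  limit : Tendsto f atTop (𝓝 fe)
  limit_mem_range : fe ∈ range B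
  equilibrium : (1 + 1 / δ) • A ye = fe

/-- The right-hand side `g(t) + f(t) - fe + B ũ(t)` of the translated control system, where
`g(t) = (1/δ) e^{-δ t} A ye`. -/
def translatedRHS (A : H →ₗ.[ℝ] H) (B : U →L[ℝ] H) (δ : ℝ) (f : ℝ → H) (fe : H) (ye : A.domain)
    (ut : ℝ → U) (t : ℝ) : H :=
  ((1 / δ) * Real.exp (-δ * t)) • A ye + f t - fe + B (ut t)

/-- `ut` arises from the control `u` by absorbing the forcing:
`u(t) = ut(t) + f̃(t) - (1 - e^{-δ t} / (1 + δ)) f̃ₑ`, with `B f̃ = f` and `B f̃ₑ = fe`. -/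
def Absorbs (B : U →L[ℝ] H) (δ : ℝ) (f : ℝ → H) (fe : H) (u ut : ℝ → U) : Prop :=
  ∃ (ft : ℝ → U) (fte : U), (∀ t ≥ 0, B (ft t) = f t) ∧ B fte = fe ∧
    ∀ t ≥ 0, u t = ut t + ft t - (1 - Real.exp (-δ * t) / (1 + δ)) • fte

/-- Controls `ut` that arise from `u` exist, and for each of them the translated control system
has exactly one solution on `[0, ∞)`; it decays like `C e^{-γ t} |y₀ - ye|`, and it is a classical
solution if the initial value is in `D(A)`. -/
def Stabilizes (A : H →ₗ.[ℝ] H) (B : U →L[ℝ] H) (δ γ C : ℝ) (f : ℝ → H) (fe : H) (ye : A.domain)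
    (y₀ : H) (u : ℝ → U) : Prop :=
  (∃ ut, Absorbs B δ f fe u ut) ∧
  ∀ ut, Absorbs B δ f fe u ut →
    ∃ y : ℝ → H, IsSolution A δ (translatedRHS A B δ f fe ye ut) (y₀ - ye) y ∧
      (∀ z, IsSolution A δ (translatedRHS A B δ f fe ye ut) (y₀ - ye) z → EqOn z y (Ici 0)) ∧
      (y₀ ∈ A.domain →
        IsClassicalSolution A δ (translatedRHS A B δ f fe ye ut) (y₀ - ye) y) ∧
      ∀ t ≥ 0, ‖y t‖ ≤ C * Real.exp (-γ * t) * ‖y₀ - ye‖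

/-- The control `u(t) = ∑_{i ≤ M} v_i(t) Φ_i` with `Φ_i = φ_i`. -/
def finiteControl {A : H →ₗ.[ℝ] H} (ι : A.domain →ₗ[ℝ] U) (φ : ℕ → A.domain) {M : ℕ}
    (v : Fin M → ℝ → ℝ) (t : ℝ) : U :=
  ∑ i, v i t • ι (φ i)

end

end PIDE

/-! Absorbing the forcing leaves y' + Ay + A(β∗y) = Bu with initial value x = y₀ - y_e
(`IsForcing.translatedRHS_eq`). With z = β∗y, so that z' = y - δz, the eigenbasis splits this into
planar systems y' = -λy - λz + h, z' = y - δz, one for each mode (`IsMode`), whose characteristic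
roots are -μ⁺ and -μ⁻.

Well-posedness rests on bounds uniform in λ. In the variables z and w = y + z the large coefficient
multiplies w alone; this gives an energy estimate (`IsMode.energy_le`) and control of λz and λw, up
to t = 0 when x is in D(A) (`IsMode.mul_abs_le`). By Parseval the series of the modes, of their
derivatives and of Ay then converge locally uniformly on the relevant intervals, and the sum is the
solution. Uniqueness holds coefficient by coefficient.

For stabilization, the first N modes are steered exactly to y = z = 0 at time T by a C² control that
vanishes from T on; as the memory variable z is steered too, these modes stay at rest. Steering is
possible because the rank assumption makes the rows of C that belong to one eigenvalue independent
(`JordanRank.rowsIndep`), hence the unobservable space is trivial (`unobs_eq_bot`) and the Gramian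
invertible (`gram_injective`). All other modes have both roots beyond the rate γ, with margins
uniform by monotonicity of λ, and decay under the rapidly decaying forcing that the control exerts
on them (`IsMode.sq_le_exp`). Parseval sums the modal bounds (`exists_stabilizing_control`).

Both parts use this control: in (a) w = v' + δv, and in (b) T = 1. -/

namespace PIDE

/-! ### Series in a Hilbert basis -/

section Series

variable {H : Type*} [NormedAddCommGroup H] [InnerProductSpace ℝ H]

/-- The vector with coefficients `c` in the Hilbert basis `b`. -/
noncomputable def synth (b : HilbertBasis ℕ ℝ H) (c : ℕ → ℝ) : H := ∑' n, c n • b n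

variable (b : HilbertBasis ℕ ℝ H)

theorem hasSum_synth {c : ℕ → ℝ} (hc : Summable fun n => c n ^ 2) :
    HasSum (fun n => c n • b n) (synth b c) := by
  have hm : Memℓp c 2 := by
    refine memℓp_gen ?_
    simpa using hc
  exact (b.hasSum_repr_symm ⟨c, hm⟩).summable.hasSum

theorem inner_synth {c : ℕ → ℝ} (hc : Summable fun n => c n ^ 2) (n : ℕ) :
    inner ℝ (b n) (synth b c) = c n := by
  have h := (hasSum_synth b hc).mapL (innerSL ℝ (b n))
  have h2 : HasSum (fun k => innerSL ℝ (b n) (c k • b k)) (c n) := by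
    convert hasSum_single n (f := fun k => innerSL ℝ (b n) (c k • b k)) ?_ using 1
    · simp [b.orthonormal.1 n]
    · intro k hk
      simp [b.orthonormal.2 hk.symm]
  exact h.unique h2

theorem basis_ext {x y : H} (h : ∀ n, inner ℝ (b n) x = inner ℝ (b n) y) : x = y := by
  apply b.repr.injective
  ext n
  simpa [b.repr_apply_apply] using h n

theorem hasSum_sq_inner (x : H) : HasSum (fun n => inner ℝ (b n) x ^ 2) (‖x‖ ^ 2) := by
  have h := b.hasSum_inner_mul_inner x x
  rw [real_inner_self_eq_norm_sq] at h
  have e : (fun n => inner ℝ (b n) x ^ 2) = fun n => inner ℝ x (b n) * inner ℝ (b n) x := by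
    funext n
    rw [real_inner_comm (b n) x, sq]
  rwa [e]

theorem summable_sq_of_abs_le {c d : ℕ → ℝ} (hd : Summable fun n => d n ^ 2)
    (h : ∀ n, |c n| ≤ d n) : Summable fun n => c n ^ 2 :=
  Summable.of_nonneg_of_le (fun _ => sq_nonneg _)
    (fun n => sq_le_sq' (by linarith [neg_abs_le (c n), h n]) ((le_abs_self _).trans (h n))) hd

theorem summable_sq_add {c d : ℕ → ℝ} (hc : Summable fun n => c n ^ 2)
    (hd : Summable fun n => d n ^ 2) : Summable fun n => (c n + d n) ^ 2 :=
  Summable.of_nonneg_of_le (fun _ => sq_nonneg _)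
    (fun n => by nlinarith [sq_nonneg (c n - d n)]) ((hc.add hd).mul_left 2)

theorem summable_sq_const_mul (r : ℝ) {c : ℕ → ℝ} (hc : Summable fun n => c n ^ 2) :
    Summable fun n => (r * c n) ^ 2 := by
  simpa [mul_pow] using hc.mul_left (r ^ 2)

theorem summable_sq_sum {ι : Type*} (s : Finset ι) {c : ι → ℕ → ℝ}
    (hc : ∀ i, Summable fun n => c i n ^ 2) : Summable fun n => (∑ i ∈ s, c i n) ^ 2 := by
  classical
  induction s using Finset.induction_on with
  | empty => simp
  | insert i s hi ih => simpa [Finset.sum_insert hi] using summable_sq_add (hc i) ih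

/-- By Parseval the squared remainder is the tail of the squared coefficients, and the tail of the
fixed ℓ² majorant `d` bounds it uniformly in `t`. -/
theorem tendstoUniformlyOn_synth {S : Set ℝ} {f : ℝ → ℕ → ℝ} {d : ℕ → ℝ}
    (hd : Summable fun n => d n ^ 2) (h : ∀ t ∈ S, ∀ n, |f t n| ≤ d n) :
    TendstoUniformlyOn (fun m t => ∑ n ∈ Finset.range m, f t n • b n)
      (fun t => synth b (f t)) atTop S := by
  rw [Metric.tendstoUniformlyOn_iff]
  intro ε hε
  have h0 := (tendsto_sum_nat_add fun n => d n ^ 2).eventually (gt_mem_nhds (pow_pos hε 2))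
  filter_upwards [h0] with m hm t ht
  have hs := summable_sq_of_abs_le hd (h t ht)
  rw [dist_eq_norm]
  set r := synth b (f t) - ∑ n ∈ Finset.range m, f t n • b n with hr
  have hsum : ∀ k, inner ℝ (b k) (∑ n ∈ Finset.range m, f t n • b n)
      = if k < m then f t k else 0 := by
    intro k
    rw [inner_sum]
    have : ∀ n, inner ℝ (b k) (f t n • b n) = if k = n then f t n else 0 := by
      intro n
      rw [inner_smul_right, orthonormal_iff_ite.mp b.orthonormal]
      split_ifs <;> simp
    simp [this, Finset.mem_range]
  have hco : ∀ k, inner ℝ (b k) r = if k < m then 0 else f t k := by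
    intro k
    rw [hr, inner_sub_right, inner_synth b hs, hsum]
    split_ifs <;> simp
  have h1 := (hasSum_nat_add_iff' m).mpr (hasSum_sq_inner b r)
  have hz : ∑ i ∈ Finset.range m, inner ℝ (b i) r ^ 2 = 0 := by
    refine Finset.sum_eq_zero fun i hi => ?_
    rw [hco, if_pos (Finset.mem_range.mp hi)]; simp
  rw [hz, sub_zero] at h1
  have h2 : Summable fun k => d (k + m) ^ 2 := (summable_nat_add_iff m).mpr hd
  have h3 : ‖r‖ ^ 2 ≤ ∑' k, d (k + m) ^ 2 := by
    refine hasSum_le (fun k => ?_) h1 h2.hasSum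
    rw [hco, if_neg (by omega)]
    have := h t ht (k + m)
    exact sq_le_sq' (by linarith [neg_abs_le (f t (k + m))]) ((le_abs_self _).trans this)
  exact lt_of_pow_lt_pow_left₀ 2 hε.le (h3.trans_lt hm)

theorem continuousOn_synth {S : Set ℝ} {f : ℝ → ℕ → ℝ} {d : ℕ → ℝ}
    (hd : Summable fun n => d n ^ 2) (h : ∀ t ∈ S, ∀ n, |f t n| ≤ d n)
    (hf : ∀ n, ContinuousOn (fun t => f t n) S) : ContinuousOn (fun t => synth b (f t)) S :=
  (tendstoUniformlyOn_synth b hd h).continuousOn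
    (Frequently.of_forall fun _ =>
      continuousOn_finsetSum _ fun n _ => (hf n).smul continuousOn_const)

theorem hasDerivAt_synth {S : Set ℝ} (hS : IsOpen S) {f f' : ℝ → ℕ → ℝ} {d d' : ℕ → ℝ}
    (hd : Summable fun n => d n ^ 2) (h : ∀ t ∈ S, ∀ n, |f t n| ≤ d n)
    (hd' : Summable fun n => d' n ^ 2) (h' : ∀ t ∈ S, ∀ n, |f' t n| ≤ d' n)
    (hf : ∀ n, ∀ t ∈ S, HasDerivAt (fun t => f t n) (f' t n) t) {t : ℝ} (ht : t ∈ S) :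
    HasDerivAt (fun t => synth b (f t)) (synth b (f' t)) t :=
  hasDerivAt_of_tendstoUniformlyOn hS (tendstoUniformlyOn_synth b hd' h')
    (Eventually.of_forall fun _ x hx =>
      HasDerivAt.fun_sum fun n _ => (hf n x hx).smul_const (b n))
    (fun _ hx => (tendstoUniformlyOn_synth b hd h).tendsto_at hx) ht

end Series

/-! ### Spectral description of the operator -/

section Operator

variable {H : Type*} [NormedAddCommGroup H] [InnerProductSpace ℝ H]
  {A : H →ₗ.[ℝ] H} {φ : ℕ → A.domain} {lam : ℕ → ℝ}

theorem IsEigenbasis.exists_hilbertBasis [CompleteSpace H] (hφ : IsEigenbasis A φ lam) :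
    ∃ b : HilbertBasis ℕ ℝ H, ∀ n, b n = φ n :=
  ⟨HilbertBasis.mk hφ.orthonormal hφ.complete.ge, fun n => by simp⟩

theorem IsEigenbasis.eigenvalue_pos [CompleteSpace H] (hA : IsAdmissibleOperator A)
    (hφ : IsEigenbasis A φ lam) (n : ℕ) : 0 < lam n := by
  have h1 : ‖(φ n : H)‖ = 1 := hφ.orthonormal.1 n
  have h := hA.posDef (φ n) (by rintro h; simp [h] at h1)
  rw [hφ.eigen, inner_smul_left, real_inner_self_eq_norm_sq, h1] at h
  simpa using h

/-- If λ_n ≤ L for all n, then φ_n = K((r - λ_n)φ_n) lies in the compact closure of the image of a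
ball of radius |r| + L. But an orthonormal sequence, with mutual distances √2, has no Cauchy
subsequence. -/
theorem IsEigenbasis.tendsto_atTop [CompleteSpace H] (hA : IsAdmissibleOperator A)
    (hφ : IsEigenbasis A φ lam) : Tendsto lam atTop atTop := by
  refine tendsto_atTop_atTop_of_monotone hφ.mono ?_
  by_contra! hcon
  obtain ⟨L, hL⟩ := hcon
  obtain ⟨r, K, hK, hK1, -⟩ := hA.compactResolvent
  have hmem : ∀ n, (φ n : H) ∈ closure (K '' Metric.closedBall 0 (|r| + L)) := by
    intro n
    apply subset_closure
    refine ⟨r • (φ n : H) - A (φ n), ?_, hK1 (φ n)⟩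
    rw [hφ.eigen, ← sub_smul, mem_closedBall_zero_iff, norm_smul, hφ.orthonormal.1 n, mul_one,
      Real.norm_eq_abs]
    have h1 := hL n
    have h2 := hφ.eigenvalue_pos hA n
    rw [abs_le]
    constructor <;> cases abs_cases r <;> linarith
  have hc := hK.isCompact_closure_image_closedBall (f := (K : H →ₗ[ℝ] H)) (|r| + L)
  obtain ⟨a, -, g, hg, hlim⟩ := hc.tendsto_subseq hmem
  have hcs := hlim.cauchySeq
  rw [Metric.cauchySeq_iff] at hcs
  obtain ⟨m, hm⟩ := hcs 1 one_pos
  have hd := hm (m + 1) (by omega) m le_rfl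
  have hne : g (m + 1) ≠ g m := (hg (Nat.lt_succ_self m)).ne'
  have hsq : ‖(φ (g (m + 1)) : H) - φ (g m)‖ ^ 2 = 2 := by
    rw [norm_sub_sq_real, hφ.orthonormal.1, hφ.orthonormal.1, hφ.orthonormal.2 hne]
    norm_num
  simp only [Function.comp_apply, dist_eq_norm] at hd
  nlinarith [norm_nonneg ((φ (g (m + 1)) : H) - φ (g m))]

/-- Self-adjointness moves `A` onto the eigenvector. This is what reduces an arbitrary solution to
scalar systems. -/
theorem IsEigenbasis.inner_apply [CompleteSpace H] (hA : IsAdmissibleOperator A)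
    (hφ : IsEigenbasis A φ lam) (x : A.domain) (n : ℕ) :
    inner ℝ (φ n : H) (A x) = lam n * inner ℝ (φ n : H) (x : H) := by
  have h := LinearPMap.adjoint_isFormalAdjoint (T := A) hA.dense
  have hs : LinearPMap.adjoint A = A := hA.selfAdjoint
  rw [hs] at h
  rw [← h (φ n) x, hφ.eigen, inner_smul_left]
  simp

/-- Partial sums of the expansion, paired with their images, lie in the graph of `A` and converge;
the graph is closed. -/
theorem IsEigenbasis.exists_mem_domain [CompleteSpace H] (hA : IsAdmissibleOperator A)
    (hφ : IsEigenbasis A φ lam) (b : HilbertBasis ℕ ℝ H) (hb : ∀ n, b n = φ n) {x : H}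
    (hx : Summable fun n => (lam n * inner ℝ (b n) x) ^ 2) :
    ∃ a : A.domain, (a : H) = x ∧ A a = synth b fun n => lam n * inner ℝ (b n) x := by
  have h1 : HasSum (fun n => inner ℝ (b n) x • b n) x := by
    simpa [b.repr_apply_apply] using b.hasSum_repr x
  have h2 := hasSum_synth b hx
  have hmem : ∀ m, (∑ n ∈ Finset.range m, inner ℝ (b n) x • b n,
      ∑ n ∈ Finset.range m, (lam n * inner ℝ (b n) x) • b n) ∈ (A.graph : Set (H × H)) := by
    intro m
    refine (LinearPMap.mem_graph_iff A).mpr ⟨∑ n ∈ Finset.range m, inner ℝ (b n) x • φ n, ?_, ?_⟩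
    · simp [hb]
    · rw [← LinearPMap.toFun_eq_coe, map_sum]
      refine Finset.sum_congr rfl fun n _ => ?_
      rw [map_smul, LinearPMap.toFun_eq_coe, hφ.eigen, hb, smul_smul, mul_comm]
  have hgr : (x, synth b fun n => lam n * inner ℝ (b n) x) ∈ (A.graph : Set (H × H)) :=
    IsClosed.mem_of_tendsto hA.closed (h1.tendsto_sum_nat.prodMk_nhds h2.tendsto_sum_nat)
      (Eventually.of_forall hmem)
  obtain ⟨a, ha1, ha2⟩ := (LinearPMap.mem_graph_iff A).mp hgr
  exact ⟨a, ha1, ha2⟩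

end Operator

/-! ### The scalar system of one mode -/

/-- `y' + l y + l z = h`, `y 0 = x`, where `z` is the convolution of `y` with the kernel:
`z' = y - δ z`, `z 0 = 0`. -/
structure IsMode (δ l x : ℝ) (h y z : ℝ → ℝ) : Prop where
  continuousOn_fst : ContinuousOn y (Ici 0)
  continuousOn_snd : ContinuousOn z (Ici 0)
  fst_zero : y 0 = x
  snd_zero : z 0 = 0
  hasDerivAt_fst : ∀ t > 0, HasDerivAt y (-l * y t - l * z t + h t) t
  hasDerivAt_snd : ∀ t > 0, HasDerivAt z (y t - δ * z t) t

theorem le_of_hasDerivAt_nonpos {f f' : ℝ → ℝ} (hf : ContinuousOn f (Ici 0))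
    (hd : ∀ t > 0, HasDerivAt f (f' t) t) {b : ℝ} (hn : ∀ t, 0 < t → t < b → f' t ≤ 0)
    {t : ℝ} (ht : 0 ≤ t) (htb : t ≤ b) : f t ≤ f 0 := by
  have hanti : AntitoneOn f (Icc 0 b) := by
    refine antitoneOn_of_deriv_nonpos (convex_Icc 0 b) (hf.mono Icc_subset_Ici_self) ?_ ?_
    · intro s hs
      rw [interior_Icc] at hs
      exact (hd s hs.1).differentiableAt.differentiableWithinAt
    · intro s hs
      rw [interior_Icc] at hs
      rw [(hd s hs.1).deriv]
      exact hn s hs.1 hs.2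
  exact hanti ⟨le_rfl, ht.trans htb⟩ ⟨ht, htb⟩ ht

theorem hasDerivAt_exp_mul_const (k t : ℝ) :
    HasDerivAt (fun t => Real.exp (k * t)) (k * Real.exp (k * t)) t := by
  simpa [mul_comm] using ((hasDerivAt_id t).const_mul k).exp

/-- Bound for the scalar equation `w' = -k w + g`. -/
theorem abs_le_of_hasDerivAt {k G b : ℝ} (hk : 0 < k) {w g : ℝ → ℝ}
    (hw : ContinuousOn w (Ici 0)) (hd : ∀ t > 0, HasDerivAt w (-k * w t + g t) t)
    (hg : ∀ t, 0 < t → t < b → |g t| ≤ G) (hG : 0 ≤ G) {t : ℝ} (ht : 0 ≤ t) (htb : t ≤ b) :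
    |w t| ≤ Real.exp (-k * t) * |w 0| + G / k := by
  have hone : ∀ (w g : ℝ → ℝ), ContinuousOn w (Ici 0) →
      (∀ t > 0, HasDerivAt w (-k * w t + g t) t) → (∀ t, 0 < t → t < b → |g t| ≤ G) →
      w t ≤ Real.exp (-k * t) * |w 0| + G / k := by
    intro w g hw hd hg
    have h := le_of_hasDerivAt_nonpos (f := fun t => Real.exp (k * t) * (w t - G / k))
      (f' := fun t => Real.exp (k * t) * (g t - G)) (b := b) ?_ ?_ ?_ ht htb
    · have he : Real.exp (-k * t) * Real.exp (k * t) = 1 := by rw [← Real.exp_add]; simp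
      have hp := Real.exp_pos (-k * t)
      have h2 := mul_le_mul_of_nonneg_left h hp.le
      rw [← mul_assoc, he] at h2
      have h3 : Real.exp (-k * t) * w 0 ≤ Real.exp (-k * t) * |w 0| :=
        mul_le_mul_of_nonneg_left (le_abs_self _) hp.le
      have h4 : 0 ≤ Real.exp (-k * t) * (G / k) := by positivity
      simp only [mul_zero, Real.exp_zero, one_mul] at h2
      linarith [mul_sub (Real.exp (-k * t)) (w 0) (G / k)]
    · exact (Continuous.continuousOn (by fun_prop)).fun_mul (hw.sub continuousOn_const)
    · intro s hs
      refine HasDerivAt.congr_deriv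
          ((hasDerivAt_exp_mul_const k s).fun_mul ((hd s hs).sub_const (G / k))) ?_
      field_simp
      ring
    · intro s hs hsb
      have := (le_abs_self _).trans (hg s hs hsb)
      exact mul_nonpos_of_nonneg_of_nonpos (Real.exp_pos _).le (by linarith)
  rw [abs_le]
  constructor
  · have h := hone (fun t => -w t) (fun t => -g t) hw.neg
      (fun t ht => (hd t ht).fun_neg.congr_deriv (by ring)) (by simpa using hg)
    simp only [abs_neg] at h
    linarith
  · exact hone w g hw hd hg

namespace IsMode

variable {δ l x : ℝ} {h y z : ℝ → ℝ}

/-- In the variables z and y + z the coefficient l survives only as damping of y + z, which is why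
estimates can be uniform in l. -/
theorem hasDerivAt_add (hm : IsMode δ l x h y z) {t : ℝ} (ht : 0 < t) :
    HasDerivAt (fun t => y t + z t)
      (-(l - 1) * (y t + z t) + (-(1 + δ) * z t + h t)) t := by
  refine HasDerivAt.congr_deriv ((hm.hasDerivAt_fst t ht).fun_add (hm.hasDerivAt_snd t ht)) ?_
  ring

theorem sub {x' : ℝ} {h' y' z' : ℝ → ℝ} (hm : IsMode δ l x h y z)
    (hm' : IsMode δ l x' h' y' z') :
    IsMode δ l (x - x') (fun t => h t - h' t) (fun t => y t - y' t) (fun t => z t - z' t) where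
  continuousOn_fst := hm.continuousOn_fst.sub hm'.continuousOn_fst
  continuousOn_snd := hm.continuousOn_snd.sub hm'.continuousOn_snd
  fst_zero := by rw [hm.fst_zero, hm'.fst_zero]
  snd_zero := by rw [hm.snd_zero, hm'.snd_zero, sub_zero]
  hasDerivAt_fst t ht := by
    refine HasDerivAt.congr_deriv
        ((hm.hasDerivAt_fst t ht).fun_sub (hm'.hasDerivAt_fst t ht)) ?_; ring
  hasDerivAt_snd t ht := by
    refine HasDerivAt.congr_deriv
        ((hm.hasDerivAt_snd t ht).fun_sub (hm'.hasDerivAt_snd t ht)) ?_; ring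

/-- Energy bound that is uniform in `l > 0`. -/
theorem energy_le (hm : IsMode δ l x h y z) (hδ : 0 < δ) (hl : 0 < l) {b G : ℝ}
    (hh : ∀ t, 0 < t → t < b → |h t| ≤ G) {t : ℝ} (ht : 0 ≤ t) (htb : t ≤ b) :
    (1 + δ) * z t ^ 2 + (y t + z t) ^ 2 ≤ Real.exp (3 * t) * (x ^ 2 + t * G ^ 2) := by
  -- The weight 1 + δ cancels the cross terms z(y + z) in the derivative of the energy. As l > 0,
  -- what is left is at most 3(y + z)² + h², whence the rate 3.
  have key := le_of_hasDerivAt_nonpos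
    (f := fun t => Real.exp (-3 * t) * ((1 + δ) * z t ^ 2 + (y t + z t) ^ 2) - t * G ^ 2)
    (f' := fun t => -3 * Real.exp (-3 * t) * ((1 + δ) * z t ^ 2 + (y t + z t) ^ 2)
      + Real.exp (-3 * t) * ((1 + δ) * (2 * z t * (y t - δ * z t))
        + 2 * (y t + z t) * (-(l - 1) * (y t + z t) + (-(1 + δ) * z t + h t))) - G ^ 2)
    (b := b) ?_ ?_ ?_ ht htb
  · simp only [hm.fst_zero, hm.snd_zero, mul_zero, Real.exp_zero, zero_mul] at key
    have he : Real.exp (3 * t) * Real.exp (-3 * t) = 1 := by rw [← Real.exp_add]; simp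
    have h1 : Real.exp (-3 * t) * ((1 + δ) * z t ^ 2 + (y t + z t) ^ 2) ≤ x ^ 2 + t * G ^ 2 := by
      linarith
    have h2 := mul_le_mul_of_nonneg_left h1 (Real.exp_pos (3 * t)).le
    rwa [← mul_assoc, he, one_mul] at h2
  · have h1 := hm.continuousOn_fst
    have h2 := hm.continuousOn_snd
    fun_prop
  · intro s hs
    have h1 := ((hm.hasDerivAt_snd s hs).fun_pow 2).const_mul (1 + δ)
    have h2 := (hm.hasDerivAt_add hs).fun_pow 2
    refine HasDerivAt.congr_deriv (((hasDerivAt_exp_mul_const (-3) s).fun_mul (h1.fun_add h2)).sub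
      ((hasDerivAt_id s).mul_const (G ^ 2))) ?_
    push_cast; ring
  · intro s hs hsb
    have hG := hh s hs hsb
    have hG2 : h s ^ 2 ≤ G ^ 2 := sq_le_sq' (by linarith [neg_abs_le (h s)])
      ((le_abs_self _).trans hG)
    have he : Real.exp (-3 * s) ≤ 1 := by rw [Real.exp_le_one_iff]; linarith
    have hp := Real.exp_pos (-3 * s)
    have h1 : -3 * ((1 + δ) * z s ^ 2 + (y s + z s) ^ 2) + ((1 + δ) * (2 * z s * (y s - δ * z s))
        + 2 * (y s + z s) * (-(l - 1) * (y s + z s) + (-(1 + δ) * z s + h s))) ≤ h s ^ 2 := by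
      have e : h s ^ 2 - (-3 * ((1 + δ) * z s ^ 2 + (y s + z s) ^ 2)
          + ((1 + δ) * (2 * z s * (y s - δ * z s))
          + 2 * (y s + z s) * (-(l - 1) * (y s + z s) + (-(1 + δ) * z s + h s))))
          = (h s - (y s + z s)) ^ 2 + 2 * l * (y s + z s) ^ 2
            + (1 + δ) * (5 + 2 * δ) * z s ^ 2 := by ring
      have : 0 ≤ (h s - (y s + z s)) ^ 2 + 2 * l * (y s + z s) ^ 2
            + (1 + δ) * (5 + 2 * δ) * z s ^ 2 := by positivity
      linarith
    have h2 := mul_le_mul_of_nonneg_left h1 hp.le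
    have h3 : Real.exp (-3 * s) * h s ^ 2 ≤ 1 * h s ^ 2 :=
      mul_le_mul_of_nonneg_right he (sq_nonneg _)
    linarith

theorem unique (hδ : 0 < δ) (hl : 0 < l) {y' z' : ℝ → ℝ} (hm : IsMode δ l x h y z)
    (hm' : IsMode δ l x h y' z') {t : ℝ} (ht : 0 ≤ t) : y t = y' t := by
  have h0 := (hm.sub hm').energy_le hδ hl (b := t) (G := 0) (by simp) ht le_rfl
  simp only [sub_self] at h0
  have h1 : 0 ≤ (1 + δ) * (z t - z' t) ^ 2 := by positivity
  have h2 := sq_nonneg (y t - y' t + (z t - z' t))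
  have h3 : (1 + δ) * (z t - z' t) ^ 2 = 0 := by
    norm_num at h0; linarith
  have h4 : z t - z' t = 0 := by
    have : (z t - z' t) ^ 2 = 0 := by
      rcases mul_eq_zero.mp h3 with h | h
      · linarith
      · exact h
    simpa using this
  rw [h4] at h0
  norm_num at h0
  linarith

theorem abs_le (hm : IsMode δ l x h y z) (hδ : 0 < δ) (hl : 0 < l) {b G : ℝ}
    (hG : 0 ≤ G) (hh : ∀ t, 0 < t → t < b → |h t| ≤ G) {t : ℝ} (ht : 0 ≤ t) (htb : t ≤ b) :
    |z t| ≤ Real.exp (2 * b) * (1 + b) * (|x| + G) ∧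
      |y t + z t| ≤ Real.exp (2 * b) * (1 + b) * (|x| + G) := by
  have h0 := hm.energy_le hδ hl hh ht htb
  have hb : 0 ≤ b := ht.trans htb
  have hR : Real.exp (3 * t) * (x ^ 2 + t * G ^ 2) ≤
      (Real.exp (2 * b) * (1 + b) * (|x| + G)) ^ 2 := by
    have e1 : Real.exp (3 * t) ≤ Real.exp (2 * b) ^ 2 := by
      rw [← Real.exp_nat_mul]
      exact Real.exp_le_exp.mpr (by push_cast; linarith)
    have e2 : x ^ 2 + t * G ^ 2 ≤ ((1 + b) * (|x| + G)) ^ 2 := by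
      have e3 : t * G ^ 2 ≤ b * G ^ 2 := mul_le_mul_of_nonneg_right htb (sq_nonneg _)
      have e4 : (0 : ℝ) ≤ 2 * b * x ^ 2 + b ^ 2 * x ^ 2 + 2 * (1 + b) ^ 2 * |x| * G + G ^ 2
        + b * G ^ 2 + b ^ 2 * G ^ 2 := by positivity
      nlinarith [sq_abs x]
    rw [mul_assoc, mul_pow]
    exact mul_le_mul e1 e2 (by positivity) (by positivity)
  have hRn : 0 ≤ Real.exp (2 * b) * (1 + b) * (|x| + G) := by positivity
  constructor
  · refine abs_le_of_sq_le_sq ?_ hRn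
    nlinarith [sq_nonneg (y t + z t), sq_nonneg (z t)]
  · refine abs_le_of_sq_le_sq ?_ hRn
    have : 0 ≤ (1 + δ) * z t ^ 2 := by positivity
    linarith

/-- Smoothing: bounds for `l z` and `l (y + z)` that are uniform in `l`. -/
theorem mul_abs_le (hm : IsMode δ l x h y z) (hδ : 0 < δ) (hl : 0 < l) {b G : ℝ}
    (hG : 0 ≤ G) (hh : ∀ t, 0 < t → t < b → |h t| ≤ G) {R : ℝ}
    (hR : R = (2 + δ) * (Real.exp (2 * b) * (1 + b) * (|x| + G)) + |x| + G)
    {t : ℝ} (ht : 0 ≤ t) (htb : t ≤ b) :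
    l * |z t| ≤ 8 * R ∧ l * |y t + z t| ≤ 2 * R + l * |x| ∧
      (0 < t → l * |y t + z t| ≤ 2 * R + 2 / t * |x|) := by
  have hb : 0 ≤ b := ht.trans htb
  set R₀ := Real.exp (2 * b) * (1 + b) * (|x| + G) with hR₀
  have hR₀n : 0 ≤ R₀ := by positivity
  have hx := abs_nonneg x
  have hcr : ∀ s, 0 ≤ s → s ≤ b → |z s| ≤ R₀ ∧ |y s + z s| ≤ R₀ :=
    fun s hs hsb => hm.abs_le hδ hl hG hh hs hsb
  have hR₀R : R₀ ≤ R := by nlinarith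
  -- For l < 2 the energy bound suffices. For l ≥ 2 the damping rate l - 1 of y + z is at least l/2.
  rcases lt_or_ge l 2 with hl2 | hl2
  · have hz := (hcr t ht htb).1
    have hw := (hcr t ht htb).2
    have h1 : l * |z t| ≤ 2 * R₀ := mul_le_mul hl2.le hz (abs_nonneg _) (by norm_num)
    have h2 : l * |y t + z t| ≤ 2 * R₀ := mul_le_mul hl2.le hw (abs_nonneg _) (by norm_num)
    refine ⟨by linarith, by nlinarith, fun h0 => ?_⟩
    have : 0 ≤ 2 / t * |x| := by positivity
    linarith
  · have hk : 0 < l - 1 := by linarith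
    have hg : ∀ s, 0 < s → s < b → |-(1 + δ) * z s + h s| ≤ (1 + δ) * R₀ + G := by
      intro s hs hsb
      refine (abs_add_le _ _).trans (add_le_add ?_ (hh s hs hsb))
      rw [abs_mul, abs_neg, abs_of_pos (by linarith : 0 < 1 + δ)]
      exact mul_le_mul_of_nonneg_left (hcr s hs.le hsb.le).1 (by linarith)
    have hG1 : 0 ≤ (1 + δ) * R₀ + G := by positivity
    have hG1R : (1 + δ) * R₀ + G ≤ R := by rw [hR]; linarith
    have hwc : ContinuousOn (fun t => y t + z t) (Ici 0) :=
      hm.continuousOn_fst.add hm.continuousOn_snd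
    have hw := abs_le_of_hasDerivAt hk (w := fun t => y t + z t)
      (g := fun t => -(1 + δ) * z t + h t) hwc (fun s hs => hm.hasDerivAt_add hs) hg hG1 ht htb
    simp only [hm.fst_zero, hm.snd_zero, add_zero] at hw
    have hlw : l * |y t + z t| ≤ 2 * ((1 + δ) * R₀ + G) + l * Real.exp (-(l - 1) * t) * |x| := by
      have h1 := mul_le_mul_of_nonneg_left hw hl.le
      have h2 : l * (((1 + δ) * R₀ + G) / (l - 1)) ≤ 2 * ((1 + δ) * R₀ + G) := by
        rw [mul_div_assoc', div_le_iff₀ hk]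
        nlinarith
      linarith
    refine ⟨?_, ?_, fun h0 => ?_⟩
    -- In u = z + (y + z)/(l - 1) the term y + z drops out of z': u' = -(1 + δ)u + O(1/(l - 1)). So
    -- u, and with it z, is of size 1/(l - 1).
    · have hu := abs_le_of_hasDerivAt (k := 1 + δ) (b := b) (G := (2 + 2 * δ) * R / (l - 1))
        (by linarith)
        (w := fun t => z t + (y t + z t) / (l - 1))
        (g := fun t => ((1 + δ) * (y t + z t) + (-(1 + δ) * z t + h t)) / (l - 1))
        (hm.continuousOn_snd.add (hwc.div_const _)) ?_ ?_
        (div_nonneg (mul_nonneg (by linarith) (hR₀n.trans hR₀R)) hk.le) ht htb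
      · simp only [hm.fst_zero, hm.snd_zero, add_zero, zero_add] at hu
        have e1 : Real.exp (-(1 + δ) * t) ≤ 1 := by
          rw [Real.exp_le_one_iff]; nlinarith
        have e2 : |z t| ≤ |z t + (y t + z t) / (l - 1)| + |(y t + z t) / (l - 1)| := by
          simpa using abs_sub (z t + (y t + z t) / (l - 1)) ((y t + z t) / (l - 1))
        rw [abs_div, abs_of_pos hk] at hu e2
        have e3 : Real.exp (-(1 + δ) * t) * (|x| / (l - 1)) ≤ 1 * (|x| / (l - 1)) :=
          mul_le_mul_of_nonneg_right e1 (by positivity)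
        have e4 : |y t + z t| / (l - 1) ≤ R₀ / (l - 1) :=
          div_le_div_of_nonneg_right (hcr t ht htb).2 hk.le
        have e5 : (2 + 2 * δ) * R / (l - 1) / (1 + δ) = 2 * R / (l - 1) := by
          field_simp
        have e6 : |z t| ≤ (|x| + 2 * R + R₀) / (l - 1) := by
          rw [add_div, add_div]; rw [e5] at hu; linarith
        have e7 : |x| + R₀ ≤ R := by nlinarith
        have e8 : |z t| ≤ 3 * R / (l - 1) :=
          e6.trans (div_le_div_of_nonneg_right (by linarith) hk.le)
        rw [le_div_iff₀ hk] at e8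
        nlinarith [abs_nonneg (z t)]
      · intro s hs
        refine HasDerivAt.congr_deriv
            ((hm.hasDerivAt_snd s hs).fun_add ((hm.hasDerivAt_add hs).div_const (l - 1))) ?_
        field_simp
        ring
      · intro s hs hsb
        rw [abs_div, abs_of_pos hk]
        refine div_le_div_of_nonneg_right ((abs_add_le _ _).trans ?_) hk.le
        have e1 : |(1 + δ) * (y s + z s)| ≤ (1 + δ) * R := by
          rw [abs_mul, abs_of_pos (by linarith : 0 < 1 + δ)]
          exact mul_le_mul_of_nonneg_left ((hcr s hs.le hsb.le).2.trans hR₀R) (by linarith)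
        have e2 := hg s hs hsb
        nlinarith
    · have e1 : Real.exp (-(l - 1) * t) ≤ 1 := by
        rw [Real.exp_le_one_iff]; nlinarith
      have : l * Real.exp (-(l - 1) * t) * |x| ≤ l * |x| :=
        mul_le_mul_of_nonneg_right (by nlinarith) hx
      linarith
    -- Smoothing factor: s ≤ eˢ with s = (l - 1)t, and l ≤ 2(l - 1).
    · have e1 : l * Real.exp (-(l - 1) * t) ≤ 2 / t := by
        have e2 : (l - 1) * t ≤ Real.exp ((l - 1) * t) :=
          (by linarith : (l - 1) * t ≤ (l - 1) * t + 1).trans (Real.add_one_le_exp _)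
        rw [neg_mul, Real.exp_neg, ← div_eq_mul_inv, div_le_div_iff₀ (Real.exp_pos _) h0]
        nlinarith
      have := mul_le_mul_of_nonneg_right e1 hx
      linarith

/-- Decay of the modes whose characteristic roots lie to the left of `-γ`. -/
theorem sq_le_exp (hm : IsMode δ l x h y z) {γ a₀ b₀ G : ℝ} (ha₀ : 0 < a₀) (hb₀ : 0 < b₀)
    (ha : a₀ ≤ l + δ - 2 * γ) (hb : b₀ ≤ l * (1 + δ - γ) + γ ^ 2 - γ * δ)
    (hh : ∀ t > 0, |h t| ≤ G * Real.exp (-(γ + 1) * t)) {t : ℝ} (ht : 0 ≤ t) :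
    y t ^ 2 ≤ (2 + 2 * (δ - γ) ^ 2 / b₀) * Real.exp (-(2 * γ) * t) *
      (x ^ 2 + G ^ 2 / (4 * a₀)) := by
  set B := l * (1 + δ - γ) + γ ^ 2 - γ * δ with hB
  -- Z = e^{γt}z solves Z'' + (l + δ - 2γ)Z' + BZ = e^{γt}h, with Z' = e^{γt}(y + (γ - δ)z). The
  -- function is the oscillator energy Z'² + BZ²; the added multiple of e^{-2t} pays for the forcing
  -- through Young's inequality against the damping.
  have key := le_of_hasDerivAt_nonpos
    (f := fun t => Real.exp (2 * γ * t) * ((y t + (γ - δ) * z t) ^ 2 + B * z t ^ 2)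
      + G ^ 2 / (4 * a₀) * Real.exp (-2 * t))
    (f' := fun t => 2 * γ * Real.exp (2 * γ * t) * ((y t + (γ - δ) * z t) ^ 2 + B * z t ^ 2)
      + Real.exp (2 * γ * t) * (2 * (y t + (γ - δ) * z t) *
        (-l * y t - l * z t + h t + (γ - δ) * (y t - δ * z t))
        + B * (2 * z t * (y t - δ * z t)))
      + G ^ 2 / (4 * a₀) * (-2 * Real.exp (-2 * t)))
    (b := t) ?_ ?_ ?_ ht le_rfl
  · simp only [hm.fst_zero, hm.snd_zero, mul_zero, Real.exp_zero] at key
    have hn : 0 ≤ G ^ 2 / (4 * a₀) * Real.exp (-2 * t) := by positivity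
    have h1 : Real.exp (2 * γ * t) * ((y t + (γ - δ) * z t) ^ 2 + B * z t ^ 2)
        ≤ x ^ 2 + G ^ 2 / (4 * a₀) := by
      norm_num at key hn; linarith
    have he : Real.exp (-(2 * γ) * t) * Real.exp (2 * γ * t) = 1 := by
      rw [← Real.exp_add]; simp
    have h2 := mul_le_mul_of_nonneg_left h1 (Real.exp_pos (-(2 * γ) * t)).le
    rw [← mul_assoc, he, one_mul] at h2
    have h3 : y t ^ 2 ≤ (2 + 2 * (δ - γ) ^ 2 / b₀) *
        ((y t + (γ - δ) * z t) ^ 2 + B * z t ^ 2) := by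
      have e1 : y t ^ 2 ≤ 2 * (y t + (γ - δ) * z t) ^ 2 + 2 * (δ - γ) ^ 2 * z t ^ 2 := by
        nlinarith [sq_nonneg (y t + 2 * (γ - δ) * z t)]
      have e2 : 2 * (δ - γ) ^ 2 * z t ^ 2 ≤ 2 * (δ - γ) ^ 2 / b₀ * (B * z t ^ 2) := by
        rw [div_mul_eq_mul_div, le_div_iff₀ hb₀]
        have : 0 ≤ (B - b₀) * (2 * (δ - γ) ^ 2 * z t ^ 2) :=
          mul_nonneg (by linarith) (by positivity)
        linarith
      have e3 : 0 ≤ 2 * (δ - γ) ^ 2 / b₀ * (y t + (γ - δ) * z t) ^ 2 := by positivity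
      have e4 : 0 ≤ B * z t ^ 2 := mul_nonneg (by linarith) (sq_nonneg _)
      nlinarith
    have hc : 0 ≤ 2 + 2 * (δ - γ) ^ 2 / b₀ := by positivity
    calc _ ≤ _ := h3
      _ ≤ _ := mul_le_mul_of_nonneg_left h2 hc
      _ = _ := by ring
  · have h1 := hm.continuousOn_fst
    have h2 := hm.continuousOn_snd
    fun_prop
  · intro s hs
    have h1 := ((hm.hasDerivAt_fst s hs).fun_add
      ((hm.hasDerivAt_snd s hs).const_mul (γ - δ))).fun_pow 2
    have h2 := ((hm.hasDerivAt_snd s hs).fun_pow 2).const_mul B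
    refine HasDerivAt.congr_deriv
        (((hasDerivAt_exp_mul_const (2 * γ) s).fun_mul (h1.fun_add h2)).add
      ((hasDerivAt_exp_mul_const (-2) s).const_mul (G ^ 2 / (4 * a₀)))) ?_
    push_cast; ring
  · intro s hs _
    set P := y s + (γ - δ) * z s with hP
    have e1 : 2 * γ * Real.exp (2 * γ * s) * (P ^ 2 + B * z s ^ 2)
      + Real.exp (2 * γ * s) * (2 * P *
        (-l * y s - l * z s + h s + (γ - δ) * (y s - δ * z s))
        + B * (2 * z s * (y s - δ * z s)))
        = Real.exp (2 * γ * s) * (-2 * (l + δ - 2 * γ) * P ^ 2 + 2 * P * h s) := by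
      rw [hB, hP]; ring
    rw [e1]
    have e2 : -2 * (l + δ - 2 * γ) * P ^ 2 + 2 * P * h s ≤ h s ^ 2 / (2 * a₀) := by
      rw [le_div_iff₀ (by positivity)]
      have : 0 ≤ (l + δ - 2 * γ - a₀) * (P ^ 2 * a₀) := mul_nonneg (by linarith) (by positivity)
      nlinarith [sq_nonneg (2 * a₀ * P - h s)]
    have e3 : h s ^ 2 ≤ G ^ 2 * Real.exp (-(2 * γ) * s) * Real.exp (-2 * s) := by
      have h1 := hh s hs
      have h2 : h s ^ 2 ≤ (G * Real.exp (-(γ + 1) * s)) ^ 2 :=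
        sq_le_sq' (by linarith [neg_abs_le (h s)]) ((le_abs_self _).trans h1)
      refine h2.trans_eq ?_
      rw [mul_pow, ← Real.exp_nat_mul, mul_assoc, ← Real.exp_add]
      congr 2
      push_cast; ring
    have he : Real.exp (2 * γ * s) * Real.exp (-(2 * γ) * s) = 1 := by
      rw [← Real.exp_add]; simp
    have hp := Real.exp_pos (2 * γ * s)
    have e4 : Real.exp (2 * γ * s) * h s ^ 2 ≤ G ^ 2 * Real.exp (-2 * s) := by
      calc _ ≤ Real.exp (2 * γ * s) * (G ^ 2 * Real.exp (-(2 * γ) * s) * Real.exp (-2 * s)) :=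
            mul_le_mul_of_nonneg_left e3 hp.le
        _ = (Real.exp (2 * γ * s) * Real.exp (-(2 * γ) * s)) * (G ^ 2 * Real.exp (-2 * s)) := by
            ring
        _ = _ := by rw [he, one_mul]
    have e5 := mul_le_mul_of_nonneg_left e2 hp.le
    have e6 : Real.exp (2 * γ * s) * (h s ^ 2 / (2 * a₀)) ≤
        G ^ 2 / (4 * a₀) * (2 * Real.exp (-2 * s)) := by
      rw [mul_div_assoc', div_mul_eq_mul_div, div_le_div_iff₀ (by positivity) (by positivity)]
      nlinarith
    linarith

end IsMode

/-! ### The flow of one mode -/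

section Flow

/-- The matrix `(-l, -l; 1, -δ)` of one mode. -/
noncomputable def modeGen (δ l : ℝ) : ℝ × ℝ →L[ℝ] ℝ × ℝ :=
  ((-l) • ContinuousLinearMap.fst ℝ ℝ ℝ - l • ContinuousLinearMap.snd ℝ ℝ ℝ).prod
    (ContinuousLinearMap.fst ℝ ℝ ℝ - δ • ContinuousLinearMap.snd ℝ ℝ ℝ)

theorem modeGen_apply (δ l : ℝ) (p : ℝ × ℝ) :
    modeGen δ l p = (-l * p.1 - l * p.2, p.1 - δ * p.2) := rfl

/-- The backward flow of one mode, applied to the direction `(1, 0)` of the control. -/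
noncomputable def modeKer (δ l s : ℝ) : ℝ × ℝ := NormedSpace.exp (s • -modeGen δ l) (1, 0)

theorem modeKer_zero (δ l : ℝ) : modeKer δ l 0 = (1, 0) := by
  simp [modeKer]

theorem hasDerivAt_modeKer (δ l s : ℝ) :
    HasDerivAt (modeKer δ l) (-modeGen δ l (modeKer δ l s)) s := by
  have h := (hasDerivAt_exp_smul_const' (-modeGen δ l) s).clm_apply
    (hasDerivAt_const s ((1, 0) : ℝ × ℝ))
  exact h.congr_deriv (by simp [modeKer])

theorem contDiff_modeKer (δ l : ℝ) (n : WithTop ℕ∞) : ContDiff ℝ n (modeKer δ l) := by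
  have h : ContDiff ℝ n (NormedSpace.exp : (ℝ × ℝ →L[ℝ] ℝ × ℝ) → _) :=
    AnalyticOnNhd.contDiff fun x _ => NormedSpace.exp_analytic x
  exact (h.comp (contDiff_id.smul contDiff_const)).clm_apply contDiff_const

@[fun_prop]
theorem continuous_modeKer (δ l : ℝ) : Continuous (modeKer δ l) :=
  (contDiff_modeKer δ l 0).continuous

/-- Variation of constants. -/
noncomputable def modeSol (δ l x : ℝ) (h : ℝ → ℝ) (t : ℝ) : ℝ × ℝ :=
  NormedSpace.exp (t • modeGen δ l) ((x, 0) + ∫ s in (0 : ℝ)..t, h s • modeKer δ l s)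

theorem hasDerivAt_modeSol (δ l x : ℝ) {h : ℝ → ℝ} (hh : Continuous h) (t : ℝ) :
    HasDerivAt (modeSol δ l x h) (modeGen δ l (modeSol δ l x h t) + (h t, 0)) t := by
  have hc : Continuous fun s => h s • modeKer δ l s := by fun_prop
  have h1 := (hc.integral_hasStrictDerivAt 0 t).hasDerivAt.const_add ((x, 0) : ℝ × ℝ)
  have h2 := (hasDerivAt_exp_smul_const' (modeGen δ l) t).clm_apply h1
  -- Forward and backward flow cancel, so the control enters in the direction (1, 0).
  have h3 : NormedSpace.exp (t • modeGen δ l) (modeKer δ l t) = (1, 0) := by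
    let : NormedAlgebra ℚ (ℝ × ℝ →L[ℝ] ℝ × ℝ) := NormedAlgebra.restrictScalars ℚ ℝ _
    have hc : Commute (t • modeGen δ l) (t • -modeGen δ l) := by
      rw [smul_neg]
      exact (Commute.refl (t • modeGen δ l)).neg_right
    have h4 := NormedSpace.exp_add_of_commute hc
    rw [smul_neg, add_neg_cancel, NormedSpace.exp_zero] at h4
    have h5 := congrArg (fun L : ℝ × ℝ →L[ℝ] ℝ × ℝ => L (1, 0)) h4
    rw [modeKer, smul_neg]
    simpa using h5.symm
  refine h2.congr_deriv ?_
  rw [map_smul, h3]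
  simp [modeSol]

theorem isMode_modeSol (δ l x : ℝ) {h : ℝ → ℝ} (hh : Continuous h) :
    IsMode δ l x h (fun t => (modeSol δ l x h t).1) (fun t => (modeSol δ l x h t).2) where
  continuousOn_fst := Continuous.continuousOn <| continuous_fst.comp <|
    continuous_iff_continuousAt.mpr fun t => (hasDerivAt_modeSol δ l x hh t).continuousAt
  continuousOn_snd := Continuous.continuousOn <| continuous_snd.comp <|
    continuous_iff_continuousAt.mpr fun t => (hasDerivAt_modeSol δ l x hh t).continuousAt
  fst_zero := by simp [modeSol]
  snd_zero := by simp [modeSol]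
  hasDerivAt_fst t _ := by
    exact ((ContinuousLinearMap.fst ℝ ℝ ℝ).hasFDerivAt.comp_hasDerivAt t
      (hasDerivAt_modeSol δ l x hh t)).congr_deriv (by simp [modeGen_apply])
  hasDerivAt_snd t _ := by
    exact ((ContinuousLinearMap.snd ℝ ℝ ℝ).hasFDerivAt.comp_hasDerivAt t
      (hasDerivAt_modeSol δ l x hh t)).congr_deriv (by simp [modeGen_apply])

/-- The moment condition makes the bracket in the variation of constants formula vanish at `T`, and
the integral does not change afterwards. -/
theorem modeSol_eq_zero {δ l x T : ℝ} {h : ℝ → ℝ} (hh : Continuous h)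
    (h0 : ∀ t ≥ T, h t = 0) (hx : ∫ s in (0 : ℝ)..T, h s • modeKer δ l s = -(x, 0))
    {t : ℝ} (ht : T ≤ t) : modeSol δ l x h t = 0 := by
  have hc : Continuous fun s => h s • modeKer δ l s := by fun_prop
  have h1 : ∫ s in T..t, h s • modeKer δ l s = 0 := by
    rw [intervalIntegral.integral_congr (g := fun _ => (0 : ℝ × ℝ))]
    · simp
    · intro s hs
      rw [uIcc_of_le ht] at hs
      simp [h0 s hs.1]
  rw [modeSol, ← intervalIntegral.integral_add_adjacent_intervals
    (hc.intervalIntegrable 0 T) (hc.intervalIntegrable T t), h1, hx, add_zero,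
    add_neg_cancel, map_zero]

end Flow

/-! ### Null controllability of finitely many modes -/

section Control

variable {N M : ℕ}

/-- The pairing of `ℝ × ℝ` with itself. -/
noncomputable def pairL (p : ℝ × ℝ) : ℝ × ℝ →L[ℝ] ℝ :=
  p.1 • ContinuousLinearMap.fst ℝ ℝ ℝ + p.2 • ContinuousLinearMap.snd ℝ ℝ ℝ

theorem pairL_apply (p q : ℝ × ℝ) : pairL p q = p.1 * q.1 + p.2 * q.2 := rfl

/-- The functional of the `i`-th control on the adjoint state `η`. -/
noncomputable def obs (δ : ℝ) (l : Fin N → ℝ) (c : Fin N → Fin M → ℝ) (η : Fin N → ℝ × ℝ)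
    (i : Fin M) (s : ℝ) : ℝ := ∑ m, c m i * pairL (η m) (modeKer δ (l m) s)

@[fun_prop]
theorem continuous_obs (δ : ℝ) (l : Fin N → ℝ) (c : Fin N → Fin M → ℝ) (η : Fin N → ℝ × ℝ)
    (i : Fin M) : Continuous (obs δ l c η i) := by
  unfold obs
  fun_prop

/-- The adjoint of the mode matrices, acting blockwise. -/
def adjGen (δ : ℝ) (l : Fin N → ℝ) : (Fin N → ℝ × ℝ) →ₗ[ℝ] (Fin N → ℝ × ℝ) where
  toFun η m := (-l m * (η m).1 + (η m).2, -l m * (η m).1 - δ * (η m).2)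
  map_add' η ζ := by
    funext m
    ext <;> simp <;> ring
  map_smul' r η := by
    funext m
    ext <;> simp <;> ring

theorem pairL_adjGen (δ : ℝ) (l : Fin N → ℝ) (η : Fin N → ℝ × ℝ) (m : Fin N) (q : ℝ × ℝ) :
    pairL (adjGen δ l η m) q = pairL (η m) (modeGen δ (l m) q) := by
  simp only [pairL_apply, modeGen_apply, adjGen, LinearMap.coe_mk, AddHom.coe_mk]
  ring

/-- The adjoint states that the controls do not see on `[0, T)`. -/
def unobs (δ T : ℝ) (l : Fin N → ℝ) (c : Fin N → Fin M → ℝ) : Submodule ℝ (Fin N → ℝ × ℝ) where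
  carrier := {η | ∀ i, ∀ s ∈ Ico 0 T, obs δ l c η i s = 0}
  zero_mem' := by intro i s _; simp [obs, pairL_apply]
  add_mem' {η ζ} hη hζ := by
    intro i s hs
    have h1 := hη i s hs
    have h2 := hζ i s hs
    simp only [obs, pairL_apply, Pi.add_apply, Prod.fst_add, Prod.snd_add] at *
    rw [← add_zero (0 : ℝ)]
    nth_rewrite 1 [← h1]
    rw [← h2, ← Finset.sum_add_distrib]
    exact Finset.sum_congr rfl fun m _ => by ring
  smul_mem' r η hη := by
    intro i s hs
    have h1 := hη i s hs
    simp only [obs, pairL_apply, Pi.smul_apply, Prod.smul_fst, Prod.smul_snd, smul_eq_mul] at *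
    rw [← mul_zero r, ← h1, Finset.mul_sum]
    exact Finset.sum_congr rfl fun m _ => by ring

theorem hasDerivAt_obs (δ : ℝ) (l : Fin N → ℝ) (c : Fin N → Fin M → ℝ) (η : Fin N → ℝ × ℝ)
    (i : Fin M) (s : ℝ) : HasDerivAt (obs δ l c η i) (-obs δ l c (adjGen δ l η) i s) s := by
  have h : HasDerivAt (fun s => ∑ m, c m i * pairL (η m) (modeKer δ (l m) s))
      (∑ m, c m i * pairL (η m) (-modeGen δ (l m) (modeKer δ (l m) s))) s :=
    HasDerivAt.fun_sum fun m _ =>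
      ((pairL (η m)).hasFDerivAt.comp_hasDerivAt s (hasDerivAt_modeKer δ (l m) s)).const_mul _
  refine h.congr_deriv ?_
  simp only [obs, pairL_adjGen, map_neg, mul_neg, Finset.sum_neg_distrib]

/-- A function that vanishes on [0, T) has zero derivative there, one-sided at 0; differentiating
the observation applies the adjoint generator, up to sign. -/
theorem adjGen_mem_unobs {δ T : ℝ} {l : Fin N → ℝ} {c : Fin N → Fin M → ℝ}
    {η : Fin N → ℝ × ℝ} (hη : η ∈ unobs δ T l c) : adjGen δ l η ∈ unobs δ T l c := by
  intro i s hs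
  have h1 := (hasDerivAt_obs δ l c η i s).hasDerivWithinAt (s := Ico 0 T)
  have h2 : HasDerivWithinAt (obs δ l c η i) 0 (Ico 0 T) s :=
    (hasDerivWithinAt_const s (Ico 0 T) (0 : ℝ)).congr (fun t ht => hη i t ht) (hη i s hs)
  have := (uniqueDiffOn_Ico 0 T s hs).eq_deriv _ h1 h2
  linarith

/-- By Cayley–Hamilton, each block a of the adjoint satisfies a² + (l + δ)a + l(1 + δ) = 0, that is,
l(a + 1 + δ) = -(a² + δa). The map a + 1 + δ is injective, since its determinant is 1 + δ, hence
bijective on the finite-dimensional invariant space. So multiplication by l preserves that space,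
and polynomials in l can separate the eigenvalues. -/
theorem smul_mem_unobs {δ T : ℝ} (hδ : 0 < δ) {l : Fin N → ℝ} {c : Fin N → Fin M → ℝ}
    {η : Fin N → ℝ × ℝ} (hη : η ∈ unobs δ T l c) :
    (fun m => l m • η m) ∈ unobs δ T l c := by
  set V := unobs δ T l c
  set D : (Fin N → ℝ × ℝ) →ₗ[ℝ] (Fin N → ℝ × ℝ) := adjGen δ l + (1 + δ) • LinearMap.id with hD
  have hmap : ∀ η ∈ V, D η ∈ V := fun η hη =>
    V.add_mem (adjGen_mem_unobs hη) (V.smul_mem _ hη)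
  have hinj : Function.Injective (D.restrict hmap) := by
    rw [injective_iff_map_eq_zero]
    rintro ⟨ζ, hζ⟩ h
    have h1 := congrArg Subtype.val h
    apply Subtype.ext
    funext m
    have h2 := congrFun h1 m
    simp [hD, adjGen, Prod.ext_iff] at h2
    have h3 : (ζ m).2 = l m * (ζ m).1 := by linarith [h2.2]
    have h4 : (1 + δ) * (ζ m).1 = 0 := by rw [h3] at h2; linarith [h2.1]
    have h5 : (ζ m).1 = 0 := by
      rcases mul_eq_zero.mp h4 with h | h
      · linarith
      · exact h
    ext
    · exact h5
    · simp [h3, h5]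
  obtain ⟨⟨ζ, hζ⟩, hζη⟩ := LinearMap.injective_iff_surjective.mp hinj ⟨η, hη⟩
  have h1 : D ζ = η := congrArg Subtype.val hζη
  have h2 : (fun m => l m • η m) = -(adjGen δ l (adjGen δ l ζ) + δ • adjGen δ l ζ) := by
    funext m
    rw [← h1]
    ext <;> simp [hD, adjGen] <;> ring
  rw [h2]
  exact V.neg_mem (V.add_mem (adjGen_mem_unobs (adjGen_mem_unobs hζ))
    (V.smul_mem _ (adjGen_mem_unobs hζ)))

theorem prod_smul_mem_unobs {δ T : ℝ} (hδ : 0 < δ) {l : Fin N → ℝ} {c : Fin N → Fin M → ℝ}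
    {η : Fin N → ℝ × ℝ} (hη : η ∈ unobs δ T l c) (S : Finset ℝ) :
    (fun m => (∏ r ∈ S, (l m - r)) • η m) ∈ unobs δ T l c := by
  classical
  induction S using Finset.induction_on with
  | empty => simpa using hη
  | insert r S hr ih =>
    have h := (unobs δ T l c).sub_mem (smul_mem_unobs hδ ih) ((unobs δ T l c).smul_mem r ih)
    convert h using 1
    funext m
    simp only [Finset.prod_insert hr, Pi.sub_apply, Pi.smul_apply, sub_smul, mul_smul]

/-- The coefficient rows that belong to one eigenvalue are linearly independent. -/
def RowsIndep (l : Fin N → ℝ) (c : Fin N → Fin M → ℝ) : Prop :=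
  ∀ k, ∀ ξ : Fin N → ℝ, (∀ j, l j ≠ l k → ξ j = 0) → (∀ i, ∑ j, c j i * ξ j = 0) → ξ = 0

/-- An unobservable state is projected, up to a nonzero factor, onto the block of one eigenvalue.
There the observation at time 0 and the independence of the rows kill the first components. -/
theorem unobs_eq_bot {δ T : ℝ} (hδ : 0 < δ) (hT : 0 < T) {l : Fin N → ℝ}
    {c : Fin N → Fin M → ℝ} (hc : RowsIndep l c) : unobs δ T l c = ⊥ := by
  classical
  have hblock : ∀ k, ∀ ζ ∈ unobs δ T l c, (∀ j, l j ≠ l k → ζ j = 0) → (ζ k).1 = 0 := by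
    intro k ζ hζ hsupp
    have h := hc k (fun j => pairL (ζ j) (modeKer δ (l j) 0))
      (fun j hj => by simp [hsupp j hj, pairL_apply])
      (fun i => hζ i 0 ⟨le_rfl, hT⟩)
    simpa [pairL_apply, modeKer_zero] using congrFun h k
  rw [eq_bot_iff]
  intro η hη
  rw [Submodule.mem_bot]
  funext k
  -- The product over the other eigenvalues is the Lagrange polynomial of l k without its
  -- normalization.
  set S := (Finset.univ.image l).erase (l k) with hS
  set ζ : Fin N → ℝ × ℝ := fun m => (∏ r ∈ S, (l m - r)) • η m with hζ
  have hmem : ζ ∈ unobs δ T l c := prod_smul_mem_unobs hδ hη S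
  have hsupp : ∀ j, l j ≠ l k → ζ j = 0 := by
    intro j hj
    have : ∏ r ∈ S, (l j - r) = 0 :=
      Finset.prod_eq_zero (i := l j) (by simp [hS, hj]) (sub_self _)
    simp [hζ, this]
  have h1 := hblock k ζ hmem hsupp
  -- Once the first component is zero, the adjoint generator carries the second one into its place.
  have h2 := hblock k _ (adjGen_mem_unobs hmem) (fun j hj => by simp [adjGen, hsupp j hj])
  have h3 : (ζ k).2 = 0 := by simpa [adjGen, h1] using h2
  have h4 : ζ k = 0 := Prod.ext h1 h3
  have h5 : ∏ r ∈ S, (l k - r) ≠ 0 := by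
    rw [Finset.prod_ne_zero_iff]
    intro r hr
    exact sub_ne_zero.mpr (Finset.ne_of_mem_erase hr).symm
  exact (smul_eq_zero.mp h4).resolve_left h5

/-- The controllability Gramian with the weight `expNegInvGlue (T - s)`. -/
noncomputable def gram (δ T : ℝ) (l : Fin N → ℝ) (c : Fin N → Fin M → ℝ) :
    (Fin N → ℝ × ℝ) →ₗ[ℝ] (Fin N → ℝ × ℝ) where
  toFun η n := ∫ s in (0 : ℝ)..T,
    (∑ i, c n i * (expNegInvGlue (T - s) * obs δ l c η i s)) • modeKer δ (l n) s
  map_add' η ζ := by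
    have hg : Continuous expNegInvGlue := (expNegInvGlue.contDiff (n := 0)).continuous
    funext n
    simp only [Pi.add_apply]
    rw [← intervalIntegral.integral_add
      (Continuous.intervalIntegrable (by fun_prop) _ _)
      (Continuous.intervalIntegrable (by fun_prop) _ _)]
    refine intervalIntegral.integral_congr fun s _ => ?_
    simp only [← add_smul, ← Finset.sum_add_distrib]
    congr 1
    refine Finset.sum_congr rfl fun i _ => ?_
    rw [← mul_add, ← mul_add, obs, obs, obs, ← Finset.sum_add_distrib]
    congr 2
    refine Finset.sum_congr rfl fun m _ => ?_
    simp [pairL_apply]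
    ring
  map_smul' r η := by
    funext n
    simp only [Pi.smul_apply, RingHom.id_apply]
    rw [← intervalIntegral.integral_smul]
    refine intervalIntegral.integral_congr fun s _ => ?_
    simp only [smul_smul, Finset.mul_sum]
    congr 1
    refine Finset.sum_congr rfl fun i _ => ?_
    rw [mul_left_comm r, mul_left_comm r]
    congr 2
    rw [obs, obs, Finset.mul_sum]
    refine Finset.sum_congr rfl fun m _ => ?_
    simp [pairL_apply]
    ring

theorem sum_pairL_gram (δ T : ℝ) (l : Fin N → ℝ) (c : Fin N → Fin M → ℝ) (η : Fin N → ℝ × ℝ) :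
    ∑ n, pairL (η n) (gram δ T l c η n) =
      ∫ s in (0 : ℝ)..T, expNegInvGlue (T - s) * ∑ i, obs δ l c η i s ^ 2 := by
  have hg : Continuous expNegInvGlue := (expNegInvGlue.contDiff (n := 0)).continuous
  have h1 : ∀ n, pairL (η n) (gram δ T l c η n) = ∫ s in (0 : ℝ)..T,
      pairL (η n) ((∑ i, c n i * (expNegInvGlue (T - s) * obs δ l c η i s)) •
        modeKer δ (l n) s) := fun n =>
    ((pairL (η n)).intervalIntegral_comp_comm
      (Continuous.intervalIntegrable (by fun_prop) _ _)).symm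
  simp only [h1]
  rw [← intervalIntegral.integral_finsetSum
    (fun n _ => Continuous.intervalIntegrable (by fun_prop) _ _)]
  refine intervalIntegral.integral_congr fun s _ => ?_
  simp only [map_smul, smul_eq_mul, Finset.sum_mul, Finset.mul_sum]
  rw [Finset.sum_comm]
  refine Finset.sum_congr rfl fun i _ => ?_
  rw [sq, ← mul_assoc]
  nth_rewrite 3 [obs]
  rw [Finset.mul_sum]
  exact Finset.sum_congr rfl fun n _ => by ring

/-- On its kernel the quadratic form `sum_pairL_gram` vanishes. The weight is positive on [0, T), so
all observations vanish there, and the state is unobservable. -/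
theorem gram_injective {δ T : ℝ} (hδ : 0 < δ) (hT : 0 < T) {l : Fin N → ℝ}
    {c : Fin N → Fin M → ℝ} (hc : RowsIndep l c) : Function.Injective (gram δ T l c) := by
  have hg : Continuous expNegInvGlue := (expNegInvGlue.contDiff (n := 0)).continuous
  rw [injective_iff_map_eq_zero]
  intro η hη
  have h0 : ∫ s in (0 : ℝ)..T, expNegInvGlue (T - s) * ∑ i, obs δ l c η i s ^ 2 = 0 := by
    rw [← sum_pairL_gram, hη]
    simp
  have hmem : η ∈ unobs δ T l c := by
    intro i s hs
    by_contra hne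
    have hpos := intervalIntegral.integral_pos hT
      (f := fun s => expNegInvGlue (T - s) * ∑ i, obs δ l c η i s ^ 2)
      (Continuous.continuousOn (by fun_prop))
      (fun t _ => mul_nonneg (expNegInvGlue.nonneg _) (Finset.sum_nonneg fun _ _ => sq_nonneg _))
      ⟨s, ⟨hs.1, hs.2.le⟩, mul_pos (expNegInvGlue.pos_of_pos (sub_pos.mpr hs.2))
        (lt_of_lt_of_le (by positivity) (Finset.single_le_sum
          (f := fun i => obs δ l c η i s ^ 2) (fun _ _ => sq_nonneg _) (Finset.mem_univ i)))⟩
    exact hpos.ne' h0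
  rw [unobs_eq_bot hδ hT hc] at hmem
  simpa using hmem

/-- An injective Gramian is surjective in finite dimension. The weight is flat at `T` and zero
beyond, which makes the control smooth across `T`. -/
theorem exists_steering {δ T : ℝ} (hδ : 0 < δ) (hT : 0 < T) {l : Fin N → ℝ}
    {c : Fin N → Fin M → ℝ} (hc : RowsIndep l c) (ξ : Fin N → ℝ × ℝ) :
    ∃ v : Fin M → ℝ → ℝ, (∀ i, ContDiff ℝ 2 (v i)) ∧ (∀ i, ∀ t ≥ T, v i t = 0) ∧
      ∀ n, ∫ s in (0 : ℝ)..T, (∑ i, c n i * v i s) • modeKer δ (l n) s = ξ n := by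
  obtain ⟨η, hη⟩ := LinearMap.injective_iff_surjective.mp (gram_injective hδ hT hc) ξ
  refine ⟨fun i s => expNegInvGlue (T - s) * obs δ l c η i s, fun i => ?_, fun i t ht => ?_,
    fun n => congrFun hη n⟩
  · refine (expNegInvGlue.contDiff.comp (contDiff_const.sub contDiff_id)).mul ?_
    unfold obs
    exact ContDiff.sum fun m _ => contDiff_const.mul
      ((pairL (η m)).contDiff.comp (contDiff_modeKer δ (l m) 2))
  · simp [expNegInvGlue.zero_of_nonpos (sub_nonpos.mpr ht)]

end Control

/-! ### Characteristic roots -/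

section Roots

theorem sqrtDisc_sq (δ l : ℝ) : sqrtDisc δ l ^ 2 = ((l - δ) ^ 2 - 4 * l : ℝ) := by
  have h := Complex.cpow_nat_inv_pow (((l - δ) ^ 2 - 4 * l : ℝ) : ℂ) two_ne_zero
  simpa only [sqrtDisc, Nat.cast_ofNat] using h

theorem muPlus_root (δ l : ℝ) :
    muPlus δ l ^ 2 - (l + δ) * muPlus δ l + l * (1 + δ) = 0 := by
  have h := sqrtDisc_sq δ l
  push_cast at h
  rw [muPlus]
  push_cast
  linear_combination h / 4

theorem muMinus_root (δ l : ℝ) :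
    muMinus δ l ^ 2 - (l + δ) * muMinus δ l + l * (1 + δ) = 0 := by
  have h := sqrtDisc_sq δ l
  push_cast at h
  rw [muMinus]
  push_cast
  linear_combination h / 4

/-- A characteristic root determines its eigenvalue. -/
theorem eq_of_common_root {δ : ℝ} (hδ : 0 < δ) {l l' : ℝ} {μ : ℂ}
    (h : μ ^ 2 - (l + δ) * μ + l * (1 + δ) = 0)
    (h' : μ ^ 2 - (l' + δ) * μ + l' * (1 + δ) = 0) : l = l' := by
  -- The difference of the two equations. The polynomial takes the value 1 + δ at μ = 1 + δ, so the
  -- second factor cannot vanish.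
  have h1 : ((l : ℂ) - l') * (1 + δ - μ) = 0 := by linear_combination h - h'
  rcases mul_eq_zero.mp h1 with h2 | h2
  · exact_mod_cast sub_eq_zero.mp h2
  · exfalso
    have h3 : (1 + δ : ℂ) = 0 := by
      linear_combination h + (μ + 1 - l) * h2
    have h4 : (1 + δ : ℝ) = 0 := by exact_mod_cast h3
    linarith

theorem muPlus_re (δ l : ℝ) : (muPlus δ l).re = (l + δ + (sqrtDisc δ l).re) / 2 := by
  have : muPlus δ l = ((1 / 2 : ℝ) : ℂ) * ((l + δ : ℝ) + sqrtDisc δ l) := by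
    rw [muPlus]; push_cast; ring
  rw [this, Complex.re_ofReal_mul, Complex.add_re, Complex.ofReal_re]
  ring

theorem muMinus_re (δ l : ℝ) : (muMinus δ l).re = (l + δ - (sqrtDisc δ l).re) / 2 := by
  have : muMinus δ l = ((1 / 2 : ℝ) : ℂ) * ((l + δ : ℝ) - sqrtDisc δ l) := by
    rw [muMinus]; push_cast; ring
  rw [this, Complex.re_ofReal_mul, Complex.sub_re, Complex.ofReal_re]
  ring

/-- Both roots lie to the right of `γ` exactly if the shifted characteristic polynomial has
positive coefficients. -/
theorem lt_re_iff (δ γ l : ℝ) :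
    (γ < (muPlus δ l).re ∧ γ < (muMinus δ l).re) ↔
      0 < l + δ - 2 * γ ∧ 0 < l * (1 + δ - γ) + γ ^ 2 - γ * δ := by
  rw [muPlus_re, muMinus_re]
  have h := sqrtDisc_sq δ l
  have hre := congrArg Complex.re h
  have him := congrArg Complex.im h
  rw [sq, Complex.mul_re, Complex.ofReal_re] at hre
  rw [sq, Complex.mul_im, Complex.ofReal_im] at him
  set p := (sqrtDisc δ l).re
  set q := (sqrtDisc δ l).im
  have hpq : p * q = 0 := by linarith
  constructor
  · rintro ⟨h1, h2⟩
    refine ⟨by linarith, ?_⟩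
    nlinarith [sq_nonneg q]
  · rintro ⟨h1, h2⟩
    have h3 : |p| < l + δ - 2 * γ := by
      rcases mul_eq_zero.mp hpq with h0 | h0
      · simpa [h0] using h1
      · refine abs_lt_of_sq_lt_sq ?_ h1.le
        rw [h0] at hre
        nlinarith
    rw [abs_lt] at h3
    constructor <;> linarith

/-- Since positions count from one and indices from zero, `lam N` is the first eigenvalue past the
last unstable position. The two quantities increase with the eigenvalue, so their values here are
margins for all later modes. -/
theorem lt_re_of_numUnstable {δ γ : ℝ} (hγδ : γ < 1 + δ) {lam : ℕ → ℝ}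
    (hlam : Tendsto lam atTop atTop) :
    0 < lam (numUnstable δ γ lam) + δ - 2 * γ ∧
      0 < lam (numUnstable δ γ lam) * (1 + δ - γ) + γ ^ 2 - γ * δ := by
  have hev : ∀ᶠ n in atTop, γ < (muPlus δ (lam n)).re ∧ γ < (muMinus δ (lam n)).re := by
    have h1 : Tendsto (fun n => lam n * (1 + δ - γ)) atTop atTop :=
      hlam.atTop_mul_const (by linarith)
    filter_upwards [hlam.eventually_gt_atTop (2 * γ - δ),
      h1.eventually_gt_atTop (γ * δ - γ ^ 2)] with n h2 h3
    exact (lt_re_iff δ γ (lam n)).mpr ⟨by linarith, by linarith⟩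
  obtain ⟨m, hm⟩ := eventually_atTop.mp hev
  set N := numUnstable δ γ lam with hN
  have hbd : ∀ (g : ℕ → ℝ), (∀ n ≥ m, γ < g n) → sSup {n | ∃ j, n = j + 1 ∧ g j ≤ γ} ≤ N →
      γ < g N := by
    intro g hg hle
    by_contra! hcon
    -- Boundedness is essential: in ℕ the supremum of an unbounded set is 0 by default.
    have hb : BddAbove {n | ∃ j, n = j + 1 ∧ g j ≤ γ} := by
      refine ⟨m, ?_⟩
      rintro n ⟨j, rfl, hj⟩
      by_contra! h
      exact absurd (hg j (by omega)) (not_lt.mpr hj)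
    have : N + 1 ≤ sSup {n | ∃ j, n = j + 1 ∧ g j ≤ γ} := le_csSup hb ⟨N, rfl, hcon⟩
    omega
  rw [← lt_re_iff]
  exact ⟨hbd (fun n => (muPlus δ (lam n)).re) (fun n hn => (hm n hn).1) (le_max_left _ _),
    hbd (fun n => (muMinus δ (lam n)).re) (fun n hn => (hm n hn).2) (le_max_right _ _)⟩

end Roots

/-! ### The rank assumptions -/

section Rank

variable {H U : Type*} [NormedAddCommGroup H] [InnerProductSpace ℝ H]
  [NormedAddCommGroup U] [InnerProductSpace ℝ U]
  {A : H →ₗ.[ℝ] H} {B : U →L[ℝ] H} {ι : A.domain →ₗ[ℝ] U} {φ : ℕ → A.domain}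
  {lam : ℕ → ℝ} {δ : ℝ} {N M : ℕ}

/-- A diagonal matrix is a Jordan matrix for any ordering, so only the general case needs treatment.
-/
theorem SemisimpleRank.jordanRank (h : SemisimpleRank A B ι φ lam δ N M) :
    JordanRank A B ι φ lam δ N M := by
  obtain ⟨R, hR, hP, hS⟩ := h
  refine ⟨R, Matrix.diagonal (eigList δ lam N), hR,
    ⟨Fintype.equivFin _, fun i j hij hne => ?_⟩, fun i => by simp, hP, hS⟩
  exact absurd (Matrix.diagonal_apply_ne _ hij) hne

/-- The eigenvalue of `A` to which an entry of `eigList` belongs. -/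
def eigOf (lam : ℕ → ℝ) (N : ℕ) : Fin N ⊕ Fin N → ℝ :=
  Sum.elim (fun j => lam j) (fun j => lam j)

theorem eigList_root (i : Fin N ⊕ Fin N) :
    eigList δ lam N i ^ 2 + (eigOf lam N i + δ) * eigList δ lam N i
      + eigOf lam N i * (1 + δ) = 0 := by
  rcases i with j | j
  · simpa [eigList, eigOf, sub_eq_add_neg] using muPlus_root δ (lam j)
  · simpa [eigList, eigOf, sub_eq_add_neg] using muMinus_root δ (lam j)

/-- A row of `R` is supported on the modes that share its eigenvalue. -/
theorem row_eq_zero (hδ : 0 < δ) {R J : Matrix (Fin N ⊕ Fin N) (Fin N ⊕ Fin N) ℂ}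
    (hJ : IsJordan J) (hd : ∀ i, J i i = eigList δ lam N i) (hRP : R * matP δ lam N = J * R)
    (i : Fin N ⊕ Fin N) (k : Fin N)
    (hk : eigOf lam N i ≠ lam k) :
    R i (Sum.inl k) = 0 ∧ R i (Sum.inr k) = 0 := by
  obtain ⟨e, he⟩ := hJ
  -- Induction runs backwards along the Jordan ordering: an off-diagonal entry leads to the next
  -- row, which has the same diagonal entry and hence the same eigenvalue of `A`. So row i acts as a
  -- left eigenvector of P in the columns of mode k.
  induction hn : Fintype.card (Fin N ⊕ Fin N) - (e i : ℕ) using Nat.strong_induction_on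
    generalizing i with
  | _ n ih =>
    have hJR : ∀ c, (c = Sum.inl k ∨ c = Sum.inr k) → (J * R) i c = J i i * R i c := by
      intro c hc
      rw [Matrix.mul_apply, Finset.sum_eq_single i]
      · intro j _ hji
        by_cases h0 : J i j = 0
        · simp [h0]
        · obtain ⟨h1, -, h3⟩ := he i j hji.symm h0
          have hLij : eigOf lam N i = eigOf lam N j := by
            have r1 := eigList_root (δ := δ) (lam := lam) i
            have r2 := eigList_root (δ := δ) (lam := lam) j
            rw [← hd j, ← h3, hd i] at r2
            refine eq_of_common_root hδ (μ := -eigList δ lam N i) ?_ ?_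
            · linear_combination r1
            · linear_combination r2
          have hlt := (e j).isLt
          have h4 := ih _ (by omega) j (hLij ▸ hk) rfl
          rcases hc with rfl | rfl
          · rw [h4.1, mul_zero]
          · rw [h4.2, mul_zero]
      · simp
    have e1 := congrFun (congrFun hRP i) (Sum.inl k)
    have e2 := congrFun (congrFun hRP i) (Sum.inr k)
    rw [hJR _ (Or.inl rfl), hd] at e1
    rw [hJR _ (Or.inr rfl), hd] at e2
    simp [Matrix.mul_apply, matP, Fintype.sum_sum_type, Matrix.diagonal_apply,
      Matrix.one_apply] at e1 e2
    have r1 := eigList_root (δ := δ) (lam := lam) i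
    set ν := eigList δ lam N i
    -- Eliminating the first component leaves the characteristic polynomial of `lam k` at a root
    -- that belongs to a different eigenvalue.
    have hb : R i (Sum.inr k) = 0 := by
      have h5 : R i (Sum.inr k) * (ν ^ 2 + (lam k + δ) * ν + lam k * (1 + δ)) = 0 := by
        linear_combination -e1 - ν * e2
      rcases mul_eq_zero.mp h5 with h6 | h6
      · exact h6
      · refine absurd (eq_of_common_root hδ (μ := -ν) ?_ ?_) hk
        · linear_combination r1
        · linear_combination h6
    refine ⟨?_, hb⟩
    rw [hb] at e2
    linear_combination e2

theorem card_le_mult (k : Fin N) : Nat.card {j : Fin N // lam j = lam k} ≤ mult lam N (lam k) := by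
  classical
  rw [Nat.card_eq_fintype_card, Fintype.card_subtype, mult]
  refine Finset.card_le_card_of_injOn (fun j => (j : ℕ)) ?_ (fun a _ b _ h => Fin.ext h)
  intro j hj
  simpa using hj

/-- By `row_eq_zero` the block of (RQ)* that belongs to one eigenvalue factors through the
corresponding columns of the coefficient matrix. Its rank, the multiplicity, is at most that of
these columns, which are therefore independent. -/
theorem JordanRank.rowsIndep (hδ : 0 < δ) (h : JordanRank A B ι φ lam δ N M) :
    RowsIndep (fun j : Fin N => lam j)
      (fun (j : Fin N) (i : Fin M) => inner ℝ (B (ι (φ i))) (φ j : H)) := by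
  classical
  obtain ⟨R, J, hR, hJ, hd, hP, hS⟩ := h
  have hRP : R * matP δ lam N = J * R := by
    rw [hP, ← mul_assoc, ← mul_assoc,
      Matrix.mul_nonsing_inv _ ((Matrix.isUnit_iff_isUnit_det R).mp hR), one_mul]
  intro k ξ hsupp hξ
  obtain ⟨hk, -⟩ := hS k
  let σ := {j : Fin N // lam j = lam k}
  let C₀ : Matrix (Fin M) σ ℂ := Matrix.of fun i j => (inner ℝ (B (ι (φ i))) (φ j.1 : H) : ℝ)
  let R₀ : Matrix σ σ ℂ := Matrix.of fun j' j => star (R (Sum.inl j.1) (Sum.inr j'.1))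
  have hfac : ((R * matQ A B ι φ N M).conjTranspose.submatrix id
      (fun j : σ => Sum.inl j.1)) = C₀ * R₀ := by
    ext i j
    rw [Matrix.submatrix_apply, Matrix.conjTranspose_apply, Matrix.mul_apply, Matrix.mul_apply,
      Fintype.sum_sum_type, star_add, star_sum, star_sum]
    have h1 : ∀ x : Fin N, star (R (Sum.inl j.1) (Sum.inr x) * matQ A B ι φ N M (Sum.inr x) i)
        = (inner ℝ (B (ι (φ i))) (φ x : H) : ℝ) * star (R (Sum.inl j.1) (Sum.inr x)) := by
      intro x
      simp [matQ, matC, mul_comm]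
    have h2 : ∀ x : Fin N, star (R (Sum.inl j.1) (Sum.inl x) * matQ A B ι φ N M (Sum.inl x) i)
        = 0 := by
      intro x
      simp [matQ]
    simp only [id, h1, h2, Finset.sum_const_zero, zero_add]
    symm
    refine Finset.sum_bij_ne_zero (fun (x : σ) _ _ => x.1) (fun _ _ _ => Finset.mem_univ _)
      (fun a _ _ b _ _ hab => Subtype.ext hab) (fun x _ hx => ?_) (fun x _ _ => rfl)
    by_cases hxk : lam x = lam k
    · exact ⟨⟨x, hxk⟩, Finset.mem_univ _, hx, rfl⟩
    · refine absurd ?_ hx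
      rw [(row_eq_zero hδ hJ hd hRP (Sum.inl j.1) x
        (by simpa [eigOf, j.2] using fun h => hxk h.symm)).2]
      simp
  have hrk : Fintype.card σ ≤ C₀.rank := by
    have h1 := Matrix.rank_mul_le_left C₀ R₀
    rw [← hfac] at h1
    have h2 := card_le_mult (lam := lam) k
    rw [Nat.card_eq_fintype_card, ← hk] at h2
    exact h2.trans h1
  have hker : LinearMap.ker C₀.mulVecLin = ⊥ := by
    have h1 := LinearMap.finrank_range_add_finrank_ker C₀.mulVecLin
    rw [Module.finrank_fintype_fun_eq_card] at h1
    rw [Matrix.rank] at hrk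
    exact Submodule.finrank_eq_zero.mp (by omega)
  have hz : C₀.mulVec (fun j => (ξ j.1 : ℂ)) = 0 := by
    funext i
    have h1 := hξ i
    rw [← Fintype.sum_subtype_add_sum_subtype (fun j : Fin N => lam j = lam k)] at h1
    have h2 : ∑ j : {j : Fin N // ¬ lam j = lam k},
        inner ℝ (B (ι (φ i))) (φ j.1 : H) * ξ j.1 = 0 :=
      Finset.sum_eq_zero fun j _ => by rw [hsupp j.1 j.2, mul_zero]
    rw [h2, add_zero] at h1
    simp only [Matrix.mulVec, dotProduct, C₀, Matrix.of_apply, Pi.zero_apply]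
    exact_mod_cast h1
  have hmem : (fun j : σ => (ξ j.1 : ℂ)) ∈ LinearMap.ker C₀.mulVecLin := by
    rw [LinearMap.mem_ker, Matrix.mulVecLin_apply, hz]
  rw [hker, Submodule.mem_bot] at hmem
  funext j
  by_cases hj : lam j = lam k
  · have := congrFun hmem ⟨j, hj⟩
    simpa using this
  · exact hsupp j hj

end Rank

/-! ### Bounds for the control -/

section Bounds

theorem contDiff_one_deriv {v : ℝ → ℝ} (hv : ContDiff ℝ 2 v) : ContDiff ℝ 1 (deriv v) := by
  rw [← one_add_one_eq_two] at hv
  exact (contDiff_succ_iff_deriv.mp hv).2.2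

/-- A control that vanishes from `T` on satisfies any exponential bound, at the price of the factor
e^{κT}. -/
theorem exists_bound_of_contDiff {T κ : ℝ} (hκ : 0 ≤ κ) {v : ℝ → ℝ} (hv : ContDiff ℝ 2 v)
    (h0 : ∀ t ≥ T, v t = 0) : ∃ K ≥ 0, ∀ t ≥ 0,
      |v t| + |deriv v t| + |deriv (deriv v) t| ≤ K * Real.exp (-κ * t) := by
  have hd1 := contDiff_one_deriv hv
  have hc : Continuous fun t => |v t| + |deriv v t| + |deriv (deriv v) t| := by
    have h1 := hv.continuous
    have h2 := hd1.continuous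
    have h3 := hd1.continuous_deriv le_rfl
    fun_prop
  obtain ⟨K, hK⟩ := (isCompact_Icc (a := 0) (b := T)).exists_bound_of_continuousOn hc.continuousOn
  refine ⟨|K| * Real.exp (κ * T), by positivity, fun t ht => ?_⟩
  rcases le_or_gt t T with htT | htT
  · have h1 := hK t ⟨ht, htT⟩
    rw [Real.norm_eq_abs] at h1
    have h2 : 1 ≤ Real.exp (κ * T) * Real.exp (-κ * t) := by
      rw [← Real.exp_add, Real.one_le_exp_iff]
      nlinarith
    calc _ ≤ |K| := ((le_abs_self _).trans h1).trans (le_abs_self _)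
      _ ≤ |K| * (Real.exp (κ * T) * Real.exp (-κ * t)) := le_mul_of_one_le_right (abs_nonneg _) h2
      _ = _ := by ring
  · have e0 : v =ᶠ[𝓝 t] fun _ => 0 := by
      filter_upwards [lt_mem_nhds htT] with s hs using h0 s hs.le
    have e1 := e0.deriv
    have e2 := e1.deriv
    rw [e0.eq_of_nhds, e1.eq_of_nhds, e2.eq_of_nhds]
    simp
    positivity

theorem deriv_eq_zero_of_vanish {T : ℝ} {v : ℝ → ℝ} (hv : Differentiable ℝ v)
    (h0 : ∀ t ≥ T, v t = 0) {t : ℝ} (ht : T ≤ t) : deriv v t = 0 := by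
  have h1 := (hv t).hasDerivAt.hasDerivWithinAt (s := Ici T)
  have h2 : HasDerivWithinAt v 0 (Ici T) t :=
    (hasDerivWithinAt_const t (Ici T) (0 : ℝ)).congr (fun s hs => h0 s hs) (h0 t ht)
  exact (uniqueDiffOn_Ici T t ht).eq_deriv _ h1 h2

/-- Controls that steer all modes to zero, linear in the initial values and with uniform bounds. -/
theorem exists_null_control {N M : ℕ} {δ T κ : ℝ} (hδ : 0 < δ) (hT : 0 < T) (hκ : 0 ≤ κ)
    {l : Fin N → ℝ} {c : Fin N → Fin M → ℝ} (hc : RowsIndep l c) :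
    ∃ K ≥ 0, ∀ (x : Fin N → ℝ) (r : ℝ), (∀ n, |x n| ≤ r) → ∃ v : Fin M → ℝ → ℝ,
      (∀ i, ContDiff ℝ 2 (v i)) ∧ (∀ i, ∀ t ≥ T, v i t = 0) ∧
      (∀ n, ∫ s in (0 : ℝ)..T, (∑ i, c n i * v i s) • modeKer δ (l n) s = -(x n, 0)) ∧
      ∀ i, ∀ t ≥ 0, |v i t| + |deriv (v i) t| + |deriv (deriv (v i)) t| ≤
        K * Real.exp (-κ * t) * r := by
  classical
  -- One control for each unit initial value (1, 0), superposed below; the memory component always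
  -- starts at zero.
  choose u hu1 hu2 hu3 using fun n : Fin N =>
    exists_steering hδ hT hc (Pi.single n (-(1, 0) : ℝ × ℝ))
  choose K hK0 hK using fun (n : Fin N) (i : Fin M) =>
    exists_bound_of_contDiff hκ (hu1 n i) (hu2 n i)
  refine ⟨∑ n, ∑ i, K n i, Finset.sum_nonneg fun n _ => Finset.sum_nonneg fun i _ => hK0 n i,
    fun x r hx => ⟨fun i t => ∑ n, x n * u n i t, fun i => ?_, fun i t ht => ?_, fun m => ?_,
      fun i t ht => ?_⟩⟩
  · exact ContDiff.sum fun n _ => contDiff_const.mul (hu1 n i)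
  · exact Finset.sum_eq_zero fun n _ => by rw [hu2 n i t ht, mul_zero]
  · have e1 : ∀ s, (∑ i, c m i * ∑ n, x n * u n i s) • modeKer δ (l m) s
        = ∑ n, x n • ((∑ i, c m i * u n i s) • modeKer δ (l m) s) := by
      intro s
      simp only [smul_smul, ← Finset.sum_smul, Finset.mul_sum]
      rw [Finset.sum_comm]
      congr 1
      exact Finset.sum_congr rfl fun _ _ => Finset.sum_congr rfl fun _ _ => by ring
    have hcu : ∀ n i, Continuous (u n i) := fun n i => (hu1 n i).continuous
    simp only [e1]
    rw [intervalIntegral.integral_finsetSum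
      (fun n _ => Continuous.intervalIntegrable (by fun_prop) _ _)]
    simp only [intervalIntegral.integral_smul, hu3, Pi.single_apply]
    simp
  · have hd : ∀ n, Differentiable ℝ (u n i) := fun n => (hu1 n i).differentiable (by norm_num)
    have hd1 : ∀ n, Differentiable ℝ (deriv (u n i)) := fun n =>
      (contDiff_one_deriv (hu1 n i)).differentiable (by norm_num)
    have e1 : deriv (fun t => ∑ n, x n * u n i t) = fun t => ∑ n, x n * deriv (u n i) t := by
      funext s
      exact (HasDerivAt.fun_sum fun n _ => ((hd n s).hasDerivAt.const_mul (x n))).deriv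
    have e2 : deriv (fun t => ∑ n, x n * deriv (u n i) t)
        = fun t => ∑ n, x n * deriv (deriv (u n i)) t := by
      funext s
      exact (HasDerivAt.fun_sum fun n _ => ((hd1 n s).hasDerivAt.const_mul (x n))).deriv
    rw [e1, e2]
    have hab : ∀ g : Fin N → ℝ, |∑ n, x n * g n| ≤ ∑ n, r * |g n| := fun g =>
      (Finset.abs_sum_le_sum_abs _ _).trans (Finset.sum_le_sum fun n _ => by
        rw [abs_mul]
        exact mul_le_mul_of_nonneg_right (hx n) (abs_nonneg _))
    have h1 := hab fun n => u n i t
    have h2 := hab fun n => deriv (u n i) t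
    have h3 := hab fun n => deriv (deriv (u n i)) t
    have h4 : ∑ n, r * |u n i t| + ∑ n, r * |deriv (u n i) t|
        + ∑ n, r * |deriv (deriv (u n i)) t|
        ≤ ∑ n, (∑ i, K n i) * Real.exp (-κ * t) * r := by
      rw [← Finset.sum_add_distrib, ← Finset.sum_add_distrib]
      refine Finset.sum_le_sum fun n _ => ?_
      have hr : 0 ≤ r := (abs_nonneg _).trans (hx n)
      have h5 : K n i ≤ ∑ i, K n i :=
        Finset.single_le_sum (f := fun i => K n i) (fun i _ => hK0 n i) (Finset.mem_univ i)
      have h6 := (hK n i t ht).trans (mul_le_mul_of_nonneg_right h5 (Real.exp_pos _).le)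
      calc _ = (|u n i t| + |deriv (u n i) t| + |deriv (deriv (u n i)) t|) * r := by ring
        _ ≤ _ := mul_le_mul_of_nonneg_right h6 hr
    rw [← Finset.sum_mul, ← Finset.sum_mul] at h4
    linarith

end Bounds

/-! ### Convolution with the kernel -/

section Conv

variable {E : Type*} [NormedAddCommGroup E] [NormedSpace ℝ E]

/-- The convolution of `y` with the kernel. -/
noncomputable def conv (δ : ℝ) (y : ℝ → E) (t : ℝ) : E :=
  ∫ s in (0 : ℝ)..t, beta δ (t - s) • y s

theorem continuous_beta (δ : ℝ) : Continuous (beta δ) := by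
  unfold beta
  fun_prop

theorem intervalIntegrable_conv (δ : ℝ) {y : ℝ → E} (hy : ContinuousOn y (Ici 0)) {t : ℝ}
    (ht : 0 ≤ t) : IntervalIntegrable (fun s => beta δ (t - s) • y s) volume 0 t := by
  refine ContinuousOn.intervalIntegrable ?_
  rw [uIcc_of_le ht]
  exact ((continuous_beta δ).comp (continuous_const.sub continuous_id)).continuousOn.smul
    (hy.mono Icc_subset_Ici_self)

/-- The exponential kernel factors, so the upper limit no longer enters the integrand; `max s 0`
makes the integrand continuous on ℝ for the fundamental theorem of calculus. -/
theorem conv_eq (δ : ℝ) (y : ℝ → E) {t : ℝ} (ht : 0 ≤ t) :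
    conv δ y t = beta δ t • ∫ s in (0 : ℝ)..t, beta δ (-s) • y (max s 0) := by
  rw [conv, ← intervalIntegral.integral_smul]
  refine intervalIntegral.integral_congr fun s hs => ?_
  rw [uIcc_of_le ht] at hs
  simp only [smul_smul, max_eq_left hs.1, beta, ← Real.exp_add]
  ring_nf

theorem inner_conv {H : Type*} [NormedAddCommGroup H] [InnerProductSpace ℝ H] [CompleteSpace H]
    (δ : ℝ) {y : ℝ → H} (hy : ContinuousOn y (Ici 0)) (e : H) {t : ℝ} (ht : 0 ≤ t) :
    inner ℝ e (conv δ y t) = conv δ (fun s => inner ℝ e (y s)) t := by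
  have h := (innerSL ℝ e).intervalIntegral_comp_comm (intervalIntegrable_conv δ hy ht)
  simpa [conv, inner_smul_right] using h.symm

theorem continuousOn_hasDerivAt_conv (δ : ℝ) {y : ℝ → ℝ} (hy : ContinuousOn y (Ici 0)) :
    ContinuousOn (conv δ y) (Ici 0) ∧
      ∀ t > 0, HasDerivAt (conv δ y) (y t - δ * conv δ y t) t := by
  have hc : Continuous fun s => beta δ (-s) • y (max s 0) :=
    ((continuous_beta δ).comp continuous_neg).smul
      (hy.comp_continuous (by fun_prop) fun s => le_max_right s 0)
  have hd : ∀ t, HasDerivAt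
      (fun t => beta δ t • ∫ s in (0 : ℝ)..t, beta δ (-s) • y (max s 0))
      (beta δ t • (beta δ (-t) • y (max t 0)) +
        (-δ * beta δ t) • ∫ s in (0 : ℝ)..t, beta δ (-s) • y (max s 0)) t := fun t =>
    (hasDerivAt_beta δ t).smul (hc.integral_hasStrictDerivAt 0 t).hasDerivAt
  refine ⟨?_, fun t ht => ?_⟩
  · have h1 : Continuous fun t => beta δ t • ∫ s in (0 : ℝ)..t, beta δ (-s) • y (max s 0) :=
      continuous_iff_continuousAt.mpr fun t => (hd t).continuousAt
    exact h1.continuousOn.congr fun t ht => conv_eq δ y ht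
  · have h1 : conv δ y =ᶠ[𝓝 t]
        fun t => beta δ t • ∫ s in (0 : ℝ)..t, beta δ (-s) • y (max s 0) := by
      filter_upwards [lt_mem_nhds ht] with s hs using conv_eq δ y hs.le
    refine ((hd t).congr_of_eventuallyEq h1).congr_deriv ?_
    rw [conv_eq δ y ht.le, max_eq_left ht.le, smul_smul]
    have : beta δ t * beta δ (-t) = 1 := by simp [beta, ← Real.exp_add]
    rw [this]
    simp only [smul_eq_mul]
    ring

/-- The difference d satisfies d' = -δd and starts at zero. -/
theorem IsMode.snd_eq_conv {δ l x : ℝ} {h y z : ℝ → ℝ} (hδ : 0 < δ) (hm : IsMode δ l x h y z)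
    {t : ℝ} (ht : 0 ≤ t) : z t = conv δ y t := by
  obtain ⟨hc, hd⟩ := continuousOn_hasDerivAt_conv δ hm.continuousOn_fst
  have h0 := abs_le_of_hasDerivAt (b := t) (G := 0) hδ (w := fun t => z t - conv δ y t)
    (g := fun _ => 0) (hm.continuousOn_snd.sub hc)
    (fun s hs => ((hm.hasDerivAt_snd s hs).fun_sub (hd s hs)).congr_deriv (by ring))
    (by simp) le_rfl ht le_rfl
  rw [hm.snd_zero] at h0
  simp [conv] at h0
  have : z t - conv δ y t = 0 := h0
  linarith

end Conv

/-! ### The equation in `H` -/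

section Equation

variable {H : Type*} [NormedAddCommGroup H] [InnerProductSpace ℝ H]
  {A : H →ₗ.[ℝ] H} {φ : ℕ → A.domain} {lam : ℕ → ℝ}

theorem continuousOn_Ici_of_Icc {E : Type*} [TopologicalSpace E] {f : ℝ → E}
    (h : ∀ T > 0, ContinuousOn f (Icc 0 T)) : ContinuousOn f (Ici 0) := by
  intro t ht
  have ht' : (0 : ℝ) ≤ t := ht
  refine (h (t + 1) (by linarith) t ⟨ht', by linarith⟩).mono_of_mem_nhdsWithin ?_
  rw [← Ici_inter_Iic]
  exact inter_mem self_mem_nhdsWithin (mem_nhdsWithin_of_mem_nhds (Iic_mem_nhds (by linarith)))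

theorem IsSolution.congr {δ : ℝ} {F G : ℝ → H} {x : H} {y : ℝ → H} (hFG : ∀ t ≥ 0, F t = G t)
    (h : IsSolution A δ F x y) : IsSolution A δ G x y := by
  obtain ⟨h1, h2, h3, h4⟩ := h
  refine ⟨h1, h2, h3, fun t ht => ?_⟩
  rw [← hFG t ht.le]
  exact h4 t ht

theorem IsClassicalSolution.congr {δ : ℝ} {F G : ℝ → H} {x : H} {y : ℝ → H}
    (hFG : ∀ t ≥ 0, F t = G t) (h : IsClassicalSolution A δ F x y) :
    IsClassicalSolution A δ G x y := by
  obtain ⟨h1, h2, z, h3, h4⟩ := h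
  refine ⟨h1, h2, z, h3, fun t ht => ?_⟩
  rw [← hFG t ht]
  exact h4 t ht

/-- The coefficients of a solution solve the scalar systems. -/
theorem IsSolution.isMode [CompleteSpace H]
    (hA : IsAdmissibleOperator A) (hφ : IsEigenbasis A φ lam) {δ : ℝ}
    {F : ℝ → H} {x : H} {y : ℝ → H} (h : IsSolution A δ F x y) (n : ℕ) :
    IsMode δ (lam n) (inner ℝ (φ n : H) x) (fun t => inner ℝ (φ n : H) (F t))
      (fun t => inner ℝ (φ n : H) (y t)) (conv δ fun t => inner ℝ (φ n : H) (y t)) := by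
  obtain ⟨h1, h2, h3, h4⟩ := h
  have hc : ContinuousOn (fun t => inner ℝ (φ n : H) (y t)) (Ici 0) :=
    continuousOn_const.inner h1
  obtain ⟨hc2, hd2⟩ := continuousOn_hasDerivAt_conv δ hc
  refine ⟨hc, hc2, by rw [h2], by simp [conv], fun t ht => ?_, hd2⟩
  have hdy : HasDerivAt y (deriv y t) t :=
    ((h3.differentiableOn one_ne_zero).differentiableAt (Ioi_mem_nhds ht)).hasDerivAt
  have hd := (innerSL ℝ (φ n : H)).hasFDerivAt.comp_hasDerivAt t hdy
  refine hd.congr_deriv ?_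
  obtain ⟨a, c, ha, hb, he⟩ := h4 t ht
  rw [innerSL_apply_apply, ← he, inner_add_right, inner_add_right, hφ.inner_apply hA,
    hφ.inner_apply hA, ha, hb, ← inner_conv δ h1 _ ht.le, conv]
  ring

variable (lam) in
/-- The candidate solution, mode by mode. -/
noncomputable def modalSolution (b : HilbertBasis ℕ ℝ H) (δ : ℝ) (F : ℝ → H) (x : H)
    (t : ℝ) : H :=
  synth b fun n => (modeSol δ (lam n) (inner ℝ (b n) x) (fun t => inner ℝ (b n) (F t)) t).1

variable {b : HilbertBasis ℕ ℝ H} {δ : ℝ} {F : ℝ → H} {G : ℕ → ℝ}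

theorem isMode_inner (b : HilbertBasis ℕ ℝ H) (δ : ℝ) (hF : Continuous F) (x : H) (l : ℝ)
    (n : ℕ) :
    IsMode δ l (inner ℝ (b n) x) (fun t => inner ℝ (b n) (F t))
      (fun t => (modeSol δ l (inner ℝ (b n) x) (fun t => inner ℝ (b n) (F t)) t).1)
      (fun t => (modeSol δ l (inner ℝ (b n) x) (fun t => inner ℝ (b n) (F t)) t).2) :=
  isMode_modeSol δ l _ (continuous_const.inner hF)

/-- The bound of the modes on `[0, T]`. -/
noncomputable def modeBound (b : HilbertBasis ℕ ℝ H) (δ T : ℝ) (G : ℕ → ℝ) (x : H) (n : ℕ) : ℝ :=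
  (2 + δ) * (Real.exp (2 * T) * (1 + T) * (|inner ℝ (b n) x| + G n)) + |inner ℝ (b n) x| + G n

theorem summable_sq_inner (b : HilbertBasis ℕ ℝ H) (x : H) :
    Summable fun n => |inner ℝ (b n) x| ^ 2 := by
  simpa [sq_abs] using (hasSum_sq_inner b x).summable

theorem summable_modeBound (hG : Summable fun n => G n ^ 2) (T : ℝ) (x : H) :
    Summable fun n => modeBound b δ T G x n ^ 2 := by
  have hx := summable_sq_inner b x
  have h1 := summable_sq_const_mul ((2 + δ) * (Real.exp (2 * T) * (1 + T))) (summable_sq_add hx hG)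
  have h2 := summable_sq_add (summable_sq_add h1 hx) hG
  refine h2.congr fun n => ?_
  simp only [modeBound]
  ring

theorem mode_bounds (hlam : ∀ n, 0 < lam n) (hδ : 0 < δ) (hF : Continuous F)
    (hFG : ∀ n, ∀ t ≥ 0, |inner ℝ (b n) (F t)| ≤ G n) (x : H) (n : ℕ) {t T : ℝ} (ht : 0 ≤ t)
    (htT : t ≤ T) {X : ℝ × ℝ}
    (hX : X = modeSol δ (lam n) (inner ℝ (b n) x) (fun t => inner ℝ (b n) (F t)) t) :
    |X.1| ≤ 2 * modeBound b δ T G x n ∧ |X.2| ≤ modeBound b δ T G x n ∧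
      lam n * |X.2| ≤ 8 * modeBound b δ T G x n ∧
      lam n * |X.1| ≤ 10 * modeBound b δ T G x n + lam n * |inner ℝ (b n) x| ∧
      (0 < t → lam n * |X.1| ≤ 10 * modeBound b δ T G x n + 2 / t * |inner ℝ (b n) x|) := by
  have hm := isMode_inner b δ hF x (lam n) n
  have hG : 0 ≤ G n := (abs_nonneg _).trans (hFG n 0 le_rfl)
  have hh : ∀ t, 0 < t → t < T → |inner ℝ (b n) (F t)| ≤ G n := fun t ht _ => hFG n t ht.le
  obtain ⟨h1, h2⟩ := hm.abs_le hδ (hlam n) hG hh ht htT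
  obtain ⟨h3, h4, h5⟩ := hm.mul_abs_le hδ (hlam n) hG hh
    (R := modeBound b δ T G x n) rfl ht htT
  rw [← hX] at h1 h2 h3 h4 h5
  have hT : 0 ≤ T := ht.trans htT
  have h6 : |X.1| ≤ |X.1 + X.2| + |X.2| := by simpa using abs_sub (X.1 + X.2) X.2
  have h7 : Real.exp (2 * T) * (1 + T) * (|inner ℝ (b n) x| + G n) ≤ modeBound b δ T G x n := by
    have h8 : 0 ≤ Real.exp (2 * T) * (1 + T) * (|inner ℝ (b n) x| + G n) := by positivity
    have := abs_nonneg (inner ℝ (b n) x)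
    unfold modeBound
    nlinarith
  have h8 := mul_le_mul_of_nonneg_left h6 (hlam n).le
  refine ⟨by linarith, by linarith, h3, by linarith, fun h0 => ?_⟩
  have := h5 h0
  linarith

theorem inner_modalSolution (hlam : ∀ n, 0 < lam n) (hδ : 0 < δ) (hF : Continuous F)
    (hG : Summable fun n => G n ^ 2) (hFG : ∀ n, ∀ t ≥ 0, |inner ℝ (b n) (F t)| ≤ G n) (x : H)
    {t : ℝ} (ht : 0 ≤ t) (n : ℕ) : inner ℝ (b n) (modalSolution lam b δ F x t) =
      (modeSol δ (lam n) (inner ℝ (b n) x) (fun t => inner ℝ (b n) (F t)) t).1 := by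
  refine inner_synth b (summable_sq_of_abs_le
    (summable_sq_const_mul 2 (summable_modeBound (b := b) (δ := δ) hG t x)) fun n => ?_) n
  exact (mode_bounds hlam hδ hF hFG x n ht le_rfl rfl).1

theorem continuousOn_modalSolution (hlam : ∀ n, 0 < lam n) (hδ : 0 < δ) (hF : Continuous F)
    (hG : Summable fun n => G n ^ 2) (hFG : ∀ n, ∀ t ≥ 0, |inner ℝ (b n) (F t)| ≤ G n) (x : H) :
    ContinuousOn (modalSolution lam b δ F x) (Ici 0) :=
  continuousOn_Ici_of_Icc fun T _ => continuousOn_synth b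
    (summable_sq_const_mul 2 (summable_modeBound (b := b) (δ := δ) hG T x))
    (fun _ ht n => (mode_bounds hlam hδ hF hFG x n ht.1 ht.2 rfl).1)
    (fun n => (isMode_inner b δ hF x (lam n) n).continuousOn_fst.mono Icc_subset_Ici_self)

theorem inner_conv_modalSolution [CompleteSpace H]
    (hlam : ∀ n, 0 < lam n) (hδ : 0 < δ) (hF : Continuous F)
    (hG : Summable fun n => G n ^ 2) (hFG : ∀ n, ∀ t ≥ 0, |inner ℝ (b n) (F t)| ≤ G n) (x : H)
    {t : ℝ} (ht : 0 ≤ t) (n : ℕ) : inner ℝ (b n) (conv δ (modalSolution lam b δ F x) t) =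
      (modeSol δ (lam n) (inner ℝ (b n) x) (fun t => inner ℝ (b n) (F t)) t).2 := by
  rw [inner_conv δ (continuousOn_modalSolution hlam hδ hF hG hFG x) _ ht,
    (isMode_inner b δ hF x (lam n) n).snd_eq_conv hδ ht, conv, conv]
  refine intervalIntegral.integral_congr fun s hs => ?_
  rw [uIcc_of_le ht] at hs
  simp only [inner_modalSolution hlam hδ hF hG hFG x hs.1]

/-- The derivative of the `n`-th mode. -/
noncomputable def modeDeriv (b : HilbertBasis ℕ ℝ H) (lam : ℕ → ℝ) (δ : ℝ) (F : ℝ → H) (x : H)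
    (t : ℝ) (n : ℕ) : ℝ :=
  -lam n * (modeSol δ (lam n) (inner ℝ (b n) x) (fun t => inner ℝ (b n) (F t)) t).1
    - lam n * (modeSol δ (lam n) (inner ℝ (b n) x) (fun t => inner ℝ (b n) (F t)) t).2
    + inner ℝ (b n) (F t)

theorem continuousOn_modeDeriv (hF : Continuous F) (x : H) (n : ℕ) :
    ContinuousOn (fun t => modeDeriv b lam δ F x t n) (Ici 0) := by
  have hm := isMode_inner b δ hF x (lam n) n
  exact ((continuousOn_const.mul hm.continuousOn_fst).sub
    (continuousOn_const.mul hm.continuousOn_snd)).add (continuous_const.inner hF).continuousOn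

theorem abs_modeDeriv_le (hlam : ∀ n, 0 < lam n) (hδ : 0 < δ) (hF : Continuous F)
    (hFG : ∀ n, ∀ t ≥ 0, |inner ℝ (b n) (F t)| ≤ G n) (x : H) (n : ℕ) {t T : ℝ} (ht : 0 ≤ t)
    (htT : t ≤ T) {r : ℝ}
    (hr : lam n * |(modeSol δ (lam n) (inner ℝ (b n) x) (fun t => inner ℝ (b n) (F t)) t).1| ≤
      10 * modeBound b δ T G x n + r) :
    |modeDeriv b lam δ F x t n| ≤ 18 * modeBound b δ T G x n + r + G n := by
  obtain ⟨-, -, h3, -, -⟩ := mode_bounds hlam hδ hF hFG x n ht htT rfl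
  have h4 := hFG n t ht
  unfold modeDeriv
  refine (abs_add_le _ _).trans (add_le_add ((abs_sub _ _).trans ?_) h4)
  rw [abs_mul, abs_mul, abs_neg, abs_of_pos (hlam n)]
  linarith

theorem summable_mode_deriv_bound (hG : Summable fun n => G n ^ 2) (T : ℝ) (x : H) {r : ℕ → ℝ}
    (hr : Summable fun n => r n ^ 2) :
    Summable fun n => (18 * modeBound b δ T G x n + r n + G n) ^ 2 :=
  summable_sq_add (summable_sq_add (summable_sq_const_mul 18 (summable_modeBound hG T x)) hr) hG

theorem mode_bound_Ioo (hlam : ∀ n, 0 < lam n) (hδ : 0 < δ) (hF : Continuous F)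
    (hFG : ∀ n, ∀ t ≥ 0, |inner ℝ (b n) (F t)| ≤ G n) (x : H) (n : ℕ) {a t T : ℝ} (ha : 0 < a)
    (ht : t ∈ Ioo a T) :
    lam n * |(modeSol δ (lam n) (inner ℝ (b n) x) (fun t => inner ℝ (b n) (F t)) t).1| ≤
      10 * modeBound b δ T G x n + 2 / a * |inner ℝ (b n) x| := by
  have ht0 : 0 < t := ha.trans ht.1
  have h := (mode_bounds hlam hδ hF hFG x n ht0.le ht.2.le rfl).2.2.2.2 ht0
  have h2 : 2 / t ≤ 2 / a := div_le_div_of_nonneg_left (by norm_num) ha ht.1.le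
  have h3 := mul_le_mul_of_nonneg_right h2 (abs_nonneg (inner ℝ (b n) x))
  linarith

theorem hasDerivAt_modalSolution (hlam : ∀ n, 0 < lam n) (hδ : 0 < δ) (hF : Continuous F)
    (hG : Summable fun n => G n ^ 2) (hFG : ∀ n, ∀ t ≥ 0, |inner ℝ (b n) (F t)| ≤ G n) (x : H)
    {t : ℝ} (ht : 0 < t) :
    HasDerivAt (modalSolution lam b δ F x) (synth b (modeDeriv b lam δ F x t)) t := by
  -- The smoothing bound blows up at 0, so a neighbourhood away from 0 is needed for a uniform
  -- majorant.
  have ha : 0 < t / 2 := by linarith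
  refine hasDerivAt_synth b (isOpen_Ioo (a := t / 2) (b := t + 1))
    (summable_sq_const_mul 2 (summable_modeBound (b := b) (δ := δ) hG (t + 1) x))
    (fun s hs n => (mode_bounds hlam hδ hF hFG x n (ha.trans hs.1).le hs.2.le rfl).1)
    (summable_mode_deriv_bound (δ := δ) hG (t + 1) x
      (summable_sq_const_mul (2 / (t / 2)) (summable_sq_inner b x)))
    (fun s hs n => abs_modeDeriv_le hlam hδ hF hFG x n (ha.trans hs.1).le hs.2.le
      (mode_bound_Ioo hlam hδ hF hFG x n ha hs))
    (fun n s hs => (isMode_inner b δ hF x (lam n) n).hasDerivAt_fst s (ha.trans hs.1))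
    ⟨by linarith, by linarith⟩

theorem continuousOn_synth_modeDeriv (hlam : ∀ n, 0 < lam n) (hδ : 0 < δ) (hF : Continuous F)
    (hG : Summable fun n => G n ^ 2) (hFG : ∀ n, ∀ t ≥ 0, |inner ℝ (b n) (F t)| ≤ G n) (x : H) :
    ContinuousOn (fun t => synth b (modeDeriv b lam δ F x t)) (Ioi 0) := by
  intro t ht
  have ht' : (0 : ℝ) < t := ht
  have ha : 0 < t / 2 := by linarith
  have h : ContinuousOn (fun t => synth b (modeDeriv b lam δ F x t)) (Ioo (t / 2) (t + 1)) :=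
    continuousOn_synth b (summable_mode_deriv_bound (δ := δ) hG (t + 1) x
      (summable_sq_const_mul (2 / (t / 2)) (summable_sq_inner b x)))
    (fun s hs n => abs_modeDeriv_le hlam hδ hF hFG x n (ha.trans hs.1).le hs.2.le
      (mode_bound_Ioo hlam hδ hF hFG x n ha hs))
    (fun n => (continuousOn_modeDeriv hF x n).mono fun s hs => (ha.trans hs.1).le)
  exact (h.continuousAt (Ioo_mem_nhds (by linarith) (by linarith))).continuousWithinAt

theorem summable_modeDeriv (hlam : ∀ n, 0 < lam n) (hδ : 0 < δ) (hF : Continuous F)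
    (hG : Summable fun n => G n ^ 2) (hFG : ∀ n, ∀ t ≥ 0, |inner ℝ (b n) (F t)| ≤ G n) (x : H)
    {t : ℝ} (ht : 0 < t) : Summable fun n => modeDeriv b lam δ F x t n ^ 2 :=
  summable_sq_of_abs_le (summable_mode_deriv_bound (δ := δ) hG t x
      (summable_sq_const_mul (2 / t) (summable_sq_inner b x)))
    (fun n => abs_modeDeriv_le hlam hδ hF hFG x n ht.le le_rfl
      ((mode_bounds hlam hδ hF hFG x n ht.le le_rfl rfl).2.2.2.2 ht))

theorem modalSolution_zero (b : HilbertBasis ℕ ℝ H) (lam : ℕ → ℝ) (δ : ℝ) (F : ℝ → H) (x : H) :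
    modalSolution lam b δ F x 0 = x := by
  refine basis_ext b fun n => ?_
  rw [modalSolution, inner_synth]
  · simp [modeSol]
  · simpa [modeSol] using (hasSum_sq_inner b x).summable

theorem isSolution_modalSolution [CompleteSpace H]
    (hA : IsAdmissibleOperator A) (hφ : IsEigenbasis A φ lam)
    (hb : ∀ n, b n = φ n) (hδ : 0 < δ) (hF : Continuous F) (hG : Summable fun n => G n ^ 2)
    (hFG : ∀ n, ∀ t ≥ 0, |inner ℝ (b n) (F t)| ≤ G n) (x : H) :
    IsSolution A δ F x (modalSolution lam b δ F x) := by
  have hlam : ∀ n, 0 < lam n := hφ.eigenvalue_pos hA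
  have hd := fun (t : ℝ) (ht : 0 < t) => hasDerivAt_modalSolution hlam hδ hF hG hFG x ht
  refine ⟨continuousOn_modalSolution hlam hδ hF hG hFG x, modalSolution_zero b lam δ F x, ?_,
    fun t ht => ?_⟩
  · rw [contDiffOn_one_iff_derivWithin isOpen_Ioi.uniqueDiffOn]
    refine ⟨fun t ht => (hd t ht).differentiableAt.differentiableWithinAt, ?_⟩
    refine (continuousOn_synth_modeDeriv hlam hδ hF hG hFG x).congr fun t ht => ?_
    rw [derivWithin_of_isOpen isOpen_Ioi ht, (hd t ht).deriv]
  · have hmb := fun n => mode_bounds hlam hδ hF hFG x n ht.le le_rfl rfl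
    have hsR := summable_modeBound (b := b) (δ := δ) hG t x
    have hs1 : Summable fun n => (lam n * inner ℝ (b n) (modalSolution lam b δ F x t)) ^ 2 := by
      refine summable_sq_of_abs_le (summable_sq_add (summable_sq_const_mul 10 hsR)
        (summable_sq_const_mul (2 / t) (summable_sq_inner b x))) fun n => ?_
      rw [inner_modalSolution hlam hδ hF hG hFG x ht.le, abs_mul, abs_of_pos (hlam n)]
      exact (hmb n).2.2.2.2 ht
    have hs2 : Summable fun n =>
        (lam n * inner ℝ (b n) (conv δ (modalSolution lam b δ F x) t)) ^ 2 := by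
      refine summable_sq_of_abs_le (summable_sq_const_mul 8 hsR) fun n => ?_
      rw [inner_conv_modalSolution hlam hδ hF hG hFG x ht.le, abs_mul, abs_of_pos (hlam n)]
      exact (hmb n).2.2.1
    obtain ⟨a, ha1, ha2⟩ := hφ.exists_mem_domain hA b hb hs1
    obtain ⟨c, hc1, hc2⟩ := hφ.exists_mem_domain hA b hb hs2
    refine ⟨a, c, ha1, hc1, basis_ext b fun n => ?_⟩
    rw [(hd t ht).deriv, ha2, hc2, inner_add_right, inner_add_right, inner_synth b hs1,
      inner_synth b hs2, inner_synth b (summable_modeDeriv hlam hδ hF hG hFG x ht),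
      inner_modalSolution hlam hδ hF hG hFG x ht.le,
      inner_conv_modalSolution hlam hδ hF hG hFG x ht.le, modeDeriv]
    ring

/-- For x in D(A) the sequence λ_n|x_n| is square summable and replaces the singular majorant
(2/t)|x_n|, so all convergence is uniform up to t = 0. -/
theorem isClassicalSolution_modalSolution [CompleteSpace H] (hA : IsAdmissibleOperator A)
    (hφ : IsEigenbasis A φ lam) (hb : ∀ n, b n = φ n) (hδ : 0 < δ) (hF : Continuous F)
    (hG : Summable fun n => G n ^ 2) (hFG : ∀ n, ∀ t ≥ 0, |inner ℝ (b n) (F t)| ≤ G n) {x : H}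
    (hx : x ∈ A.domain) : IsClassicalSolution A δ F x (modalSolution lam b δ F x) := by
  have hlam : ∀ n, 0 < lam n := hφ.eigenvalue_pos hA
  have hxs : Summable fun n => (lam n * |inner ℝ (b n) x|) ^ 2 := by
    refine (hasSum_sq_inner b (A ⟨x, hx⟩)).summable.congr fun n => ?_
    rw [hb, hφ.inner_apply hA, mul_pow, mul_pow, sq_abs]
  have hsR := fun T => summable_modeBound (b := b) (δ := δ) hG T x
  have hbd : ∀ t ≥ 0, ∀ T ≥ t, ∀ n, |modeDeriv b lam δ F x t n| ≤
      18 * modeBound b δ T G x n + lam n * |inner ℝ (b n) x| + G n := fun t ht T hT n =>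
    abs_modeDeriv_le hlam hδ hF hFG x n ht hT (mode_bounds hlam hδ hF hFG x n ht hT rfl).2.2.2.1
  have hcd : ContinuousOn (fun t => synth b (modeDeriv b lam δ F x t)) (Ici 0) :=
    continuousOn_Ici_of_Icc fun T _ => continuousOn_synth b
      (summable_mode_deriv_bound (δ := δ) hG T x hxs) (fun t ht n => hbd t ht.1 T ht.2 n)
      (fun n => (continuousOn_modeDeriv hF x n).mono Icc_subset_Ici_self)
  have hd := fun (t : ℝ) (ht : 0 < t) => hasDerivAt_modalSolution hlam hδ hF hG hFG x ht
  have hcy := continuousOn_modalSolution hlam hδ hF hG hFG x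
  have hdw : ∀ t ∈ Ici (0 : ℝ), HasDerivWithinAt (modalSolution lam b δ F x)
      (synth b (modeDeriv b lam δ F x t)) (Ici 0) t := by
    intro t ht
    rcases eq_or_lt_of_le (show (0 : ℝ) ≤ t from ht) with rfl | h0
    -- At 0 the one-sided derivative is the limit of the derivatives at positive times.
    · refine hasDerivWithinAt_Ici_of_tendsto_deriv (s := Ioi 0)
        (fun t ht => (hd t ht).differentiableAt.differentiableWithinAt)
        ((hcy 0 (mem_Ici.mpr le_rfl)).mono Ioi_subset_Ici_self) self_mem_nhdsWithin ?_
      refine Tendsto.congr' ?_ ((hcd 0 (mem_Ici.mpr le_rfl)).mono Ioi_subset_Ici_self)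
      filter_upwards [self_mem_nhdsWithin] with t ht using (hd t ht).deriv.symm
    · exact (hd t h0).hasDerivWithinAt
  have hsz : ∀ t ≥ 0, Summable fun n =>
      (lam n * inner ℝ (b n) (modalSolution lam b δ F x t)) ^ 2 := by
    intro t ht
    refine summable_sq_of_abs_le (summable_sq_add (summable_sq_const_mul 10 (hsR t)) hxs)
      fun n => ?_
    rw [inner_modalSolution hlam hδ hF hG hFG x ht, abs_mul, abs_of_pos (hlam n)]
    exact (mode_bounds hlam hδ hF hFG x n ht le_rfl rfl).2.2.2.1
  have hcz : ContinuousOn (fun t => synth b fun n =>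
      lam n * inner ℝ (b n) (modalSolution lam b δ F x t)) (Ici 0) := by
    refine continuousOn_Ici_of_Icc fun T _ => continuousOn_synth b
      (summable_sq_add (summable_sq_const_mul 10 (hsR T)) hxs) (fun t ht n => ?_)
      (fun n => (continuousOn_const.mul (continuousOn_const.inner hcy)).mono Icc_subset_Ici_self)
    rw [inner_modalSolution hlam hδ hF hG hFG x ht.1, abs_mul, abs_of_pos (hlam n)]
    exact (mode_bounds hlam hδ hF hFG x n ht.1 ht.2 rfl).2.2.2.1
  refine ⟨modalSolution_zero b lam δ F x, ?_, _, hcz, fun t ht => ⟨?_, basis_ext b fun n => ?_⟩⟩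
  · rw [contDiffOn_one_iff_derivWithin (uniqueDiffOn_Ici 0)]
    exact ⟨fun t ht => (hdw t ht).differentiableWithinAt,
      hcd.congr fun t ht => (hdw t ht).derivWithin (uniqueDiffOn_Ici 0 t ht)⟩
  · obtain ⟨a, ha1, ha2⟩ := hφ.exists_mem_domain hA b hb (hsz t ht)
    exact (LinearPMap.mem_graph_iff A).mpr ⟨a, ha1, ha2⟩
  · have hconv := inner_conv δ hcz (b n) ht
    rw [conv] at hconv
    rw [(hdw t ht).derivWithin (uniqueDiffOn_Ici 0 t ht), inner_add_right, inner_add_right, hconv,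
      inner_synth b (summable_sq_of_abs_le (summable_mode_deriv_bound (δ := δ) hG t x hxs)
        (hbd t ht t le_rfl)), inner_synth b (hsz t ht)]
    have e1 : conv δ (fun s => inner ℝ (b n) (synth b fun n =>
        lam n * inner ℝ (b n) (modalSolution lam b δ F x s))) t
        = lam n * (modeSol δ (lam n) (inner ℝ (b n) x) (fun t => inner ℝ (b n) (F t)) t).2 := by
      rw [← inner_conv_modalSolution hlam hδ hF hG hFG x ht, inner_conv δ hcy _ ht, conv, conv,
        ← intervalIntegral.integral_const_mul]
      refine intervalIntegral.integral_congr fun s hs => ?_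
      rw [uIcc_of_le ht] at hs
      simp only [inner_synth b (hsz s hs.1), smul_eq_mul]
      ring
    rw [e1, inner_modalSolution hlam hδ hF hG hFG x ht, modeDeriv]
    ring

theorem IsSolution.eqOn_modalSolution [CompleteSpace H]
    (hA : IsAdmissibleOperator A) (hφ : IsEigenbasis A φ lam)
    (hb : ∀ n, b n = φ n) (hδ : 0 < δ) (hF : Continuous F) (hG : Summable fun n => G n ^ 2)
    (hFG : ∀ n, ∀ t ≥ 0, |inner ℝ (b n) (F t)| ≤ G n) {x : H} {z : ℝ → H}
    (hz : IsSolution A δ F x z) : EqOn z (modalSolution lam b δ F x) (Ici 0) := by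
  intro t ht
  refine basis_ext b fun n => ?_
  rw [inner_modalSolution (hφ.eigenvalue_pos hA) hδ hF hG hFG x ht]
  have h1 := hz.isMode hA hφ n
  rw [← hb] at h1
  exact h1.unique hδ (hφ.eigenvalue_pos hA n) (isMode_inner b δ hF x (lam n) n) ht

end Equation

/-! ### Stabilization -/

section Stabilization

variable {H U : Type*} [NormedAddCommGroup H] [InnerProductSpace ℝ H]
  [NormedAddCommGroup U] [InnerProductSpace ℝ U]
  {A : H →ₗ.[ℝ] H} {B : U →L[ℝ] H} {ι : A.domain →ₗ[ℝ] U} {φ : ℕ → A.domain} {lam : ℕ → ℝ}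
  {δ γ : ℝ}

theorem IsForcing.exists_absorbs [CompleteSpace H] {f : ℝ → H} {fe : H} {ye : A.domain}
    (hf : IsForcing A B δ f fe ye) (u : ℝ → U) : ∃ ut, Absorbs B δ f fe u ut := by
  obtain ⟨fte, hfte⟩ := hf.limit_mem_range
  have h : ∀ t, ∃ p : U, 0 ≤ t → B p = f t := by
    intro t
    by_cases ht : 0 ≤ t
    · obtain ⟨p, hp⟩ := hf.mem_range t ht
      exact ⟨p, fun _ => hp⟩
    · exact ⟨0, fun h => absurd h ht⟩
  choose ft hft using h
  exact ⟨fun t => u t - ft t + (1 - Real.exp (-δ * t) / (1 + δ)) • fte, ft, fte,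
    fun t ht => hft t ht, hfte, fun t _ => by module⟩

/-- The absorbed forcing cancels, and only the control is left. -/
theorem IsForcing.translatedRHS_eq [CompleteSpace H] (hδ : 0 < δ) {f : ℝ → H} {fe : H}
    {ye : A.domain} (hf : IsForcing A B δ f fe ye) {u ut : ℝ → U} (h : Absorbs B δ f fe u ut)
    {t : ℝ} (ht : 0 ≤ t) : translatedRHS A B δ f fe ye ut t = B (u t) := by
  obtain ⟨ft, fte, h1, h2, h3⟩ := h
  rw [h3 t ht, map_sub, map_add, map_smul, h1 t ht, h2, translatedRHS, ← hf.equilibrium,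
    smul_smul]
  have hδ' : (1 : ℝ) + δ ≠ 0 := by linarith
  -- The coefficients of A y_e match because (1 + 1/δ)/(1 + δ) = 1/δ.
  match_scalars <;> field_simp <;> ring

theorem Stabilizes.mono {C C' : ℝ} (hC : C ≤ C') {f : ℝ → H} {fe : H} {ye : A.domain} {y₀ : H}
    {u : ℝ → U} (h : Stabilizes A B δ γ C f fe ye y₀ u) :
    Stabilizes A B δ γ C' f fe ye y₀ u := by
  refine ⟨h.1, fun ut hut => ?_⟩
  obtain ⟨y, h1, h2, h3, h4⟩ := h.2 ut hut
  refine ⟨y, h1, h2, h3, fun t ht => (h4 t ht).trans ?_⟩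
  gcongr

/-- Decay of all modes, once the first `N` of them vanish after the time `T`. -/
theorem mode_sq_le {N : ℕ} (hmono : Monotone lam) (hlam : ∀ n, 0 < lam n) (hδ : 0 < δ)
    (hγ : 0 < γ) (hγδ : γ < 1 + δ) (ha : 0 < lam N + δ - 2 * γ)
    (hb : 0 < lam N * (1 + δ - γ) + γ ^ 2 - γ * δ) {T : ℝ} (hT : 0 < T) :
    ∃ K ≥ 0, ∀ (n : ℕ) (x G : ℝ) (h y z : ℝ → ℝ), IsMode δ (lam n) x h y z →
      (∀ t ≥ 0, |h t| ≤ G * Real.exp (-(γ + 1) * t)) → (n < N → ∀ t ≥ T, y t = 0) →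
      ∀ t ≥ 0, y t ^ 2 ≤ K * Real.exp (-γ * t) ^ 2 * (x ^ 2 + G ^ 2) := by
  set a₀ := lam N + δ - 2 * γ
  set b₀ := lam N * (1 + δ - γ) + γ ^ 2 - γ * δ
  -- `K₁` serves the modes n ≥ N, which decay by themselves; `K₂` serves the others on [0, T], where
  -- e^{γT} compensates e^{-γt}.
  set K₁ := (2 + 2 * (δ - γ) ^ 2 / b₀) * (1 + 1 / (4 * a₀)) with hK₁
  set K₂ := 8 * (Real.exp (2 * T) * (1 + T)) ^ 2 * Real.exp (γ * T) ^ 2 with hK₂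
  have hK₁0 : 0 ≤ K₁ := by positivity
  have hK₂0 : 0 ≤ K₂ := by positivity
  refine ⟨K₁ + K₂, by positivity, fun n x G h y z hm hh h0 t ht => ?_⟩
  have hexp : Real.exp (-γ * t) ^ 2 = Real.exp (-(2 * γ) * t) := by
    rw [← Real.exp_nat_mul]; push_cast; ring_nf
  rcases le_or_gt N n with hn | hn
  · have hl := hmono hn
    have h1 := hm.sq_le_exp (γ := γ) (a₀ := a₀) (b₀ := b₀) ha hb
      (by simp only [a₀]; linarith)
      (by simp only [b₀]; nlinarith) (fun t ht => hh t ht.le) ht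
    rw [← hexp] at h1
    have h2 : x ^ 2 + G ^ 2 / (4 * a₀) ≤ (1 + 1 / (4 * a₀)) * (x ^ 2 + G ^ 2) := by
      have h3 : 0 ≤ 1 / (4 * a₀) * x ^ 2 := by positivity
      have h4 : G ^ 2 / (4 * a₀) = 1 / (4 * a₀) * G ^ 2 := by ring
      nlinarith [sq_nonneg G]
    calc y t ^ 2 ≤ _ := h1
      _ ≤ (2 + 2 * (δ - γ) ^ 2 / b₀) * Real.exp (-γ * t) ^ 2 *
          ((1 + 1 / (4 * a₀)) * (x ^ 2 + G ^ 2)) := by gcongr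
      _ = K₁ * Real.exp (-γ * t) ^ 2 * (x ^ 2 + G ^ 2) := by rw [hK₁]; ring
      _ ≤ (K₁ + K₂) * Real.exp (-γ * t) ^ 2 * (x ^ 2 + G ^ 2) := by gcongr; linarith
  · rcases le_or_gt t T with htT | htT
    · have hG : 0 ≤ G := by simpa using (abs_nonneg _).trans (hh 0 le_rfl)
      have hh' : ∀ t, 0 < t → t < T → |h t| ≤ G := fun t ht _ =>
        (hh t ht.le).trans (mul_le_of_le_one_right hG (Real.exp_le_one_iff.mpr (by nlinarith)))
      obtain ⟨h1, h2⟩ := hm.abs_le hδ (hlam n) hG hh' ht htT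
      have h3 : |y t| ≤ |y t + z t| + |z t| := by simpa using abs_sub (y t + z t) (z t)
      have h4 : |y t| ≤ 2 * (Real.exp (2 * T) * (1 + T) * (|x| + G)) := by linarith
      have h5 : y t ^ 2 ≤ (2 * (Real.exp (2 * T) * (1 + T) * (|x| + G))) ^ 2 :=
        sq_le_sq' (by linarith [neg_abs_le (y t)]) ((le_abs_self _).trans h4)
      have h6 : (|x| + G) ^ 2 ≤ 2 * (x ^ 2 + G ^ 2) := by
        nlinarith [sq_nonneg (|x| - G), sq_abs x]
      have h7 : 1 ≤ Real.exp (γ * T) ^ 2 * Real.exp (-γ * t) ^ 2 := by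
        rw [← mul_pow, ← Real.exp_add]
        exact one_le_pow₀ (Real.one_le_exp (by nlinarith))
      calc y t ^ 2 ≤ _ := h5
        _ = 4 * (Real.exp (2 * T) * (1 + T)) ^ 2 * (|x| + G) ^ 2 := by ring
        _ ≤ 4 * (Real.exp (2 * T) * (1 + T)) ^ 2 * (2 * (x ^ 2 + G ^ 2)) := by gcongr
        _ ≤ 4 * (Real.exp (2 * T) * (1 + T)) ^ 2 * (2 * (x ^ 2 + G ^ 2)) *
            (Real.exp (γ * T) ^ 2 * Real.exp (-γ * t) ^ 2) :=
          le_mul_of_one_le_right (by positivity) h7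
        _ = K₂ * Real.exp (-γ * t) ^ 2 * (x ^ 2 + G ^ 2) := by rw [hK₂]; ring
        _ ≤ (K₁ + K₂) * Real.exp (-γ * t) ^ 2 * (x ^ 2 + G ^ 2) := by gcongr; linarith
    · rw [h0 hn t htT.le, zero_pow two_ne_zero]
      positivity

/-- The control acts on all modes, but its effect on the modes n ≥ N is square summable in n and
decays faster than e^{-γt}, so it does not spoil their decay. -/
theorem exists_stabilizing_control [CompleteSpace H] (hA : IsAdmissibleOperator A)
    (hφ : IsEigenbasis A φ lam) (hδ : 0 < δ) (hγ : 0 < γ) (hγδ : γ < 1 + δ) {N M : ℕ}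
    (hN : N = numUnstable δ γ lam)
    (hc : RowsIndep (fun j : Fin N => lam j)
      (fun (j : Fin N) (i : Fin M) => inner ℝ (B (ι (φ i))) (φ j : H))) {T : ℝ} (hT : 0 < T) :
    ∃ C > 0, ∀ (f : ℝ → H) (fe : H) (ye : A.domain), IsForcing A B δ f fe ye → ∀ y₀ : H,
      ∃ v : Fin M → ℝ → ℝ, Stabilizes A B δ γ C f fe ye y₀ (finiteControl ι φ v) ∧
        (∀ i, ContDiff ℝ 2 (v i)) ∧ (∀ i, ∀ t ≥ T, v i t = 0) ∧
        ∀ i, ∀ t ≥ 0, |v i t| + |deriv (v i) t| + |deriv (deriv (v i)) t| ≤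
          C * Real.exp (-γ * t) * ‖y₀ - ye‖ := by
  obtain ⟨b, hb⟩ := hφ.exists_hilbertBasis
  have hlam : ∀ n, 0 < lam n := hφ.eigenvalue_pos hA
  obtain ⟨ha, hb₀⟩ := lt_re_of_numUnstable (γ := γ) hγδ (hφ.tendsto_atTop hA)
  rw [← hN] at ha hb₀
  obtain ⟨K₁, hK₁, hdecay⟩ := mode_sq_le hφ.mono hlam hδ hγ hγδ ha hb₀ hT
  -- Rate γ + 1 instead of γ: the decay estimate for the high modes needs a margin.
  obtain ⟨K, hK, hctrl⟩ := exists_null_control hδ hT (by linarith : 0 ≤ γ + 1) hc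
  set c : ℕ → Fin M → ℝ := fun n i => inner ℝ (B (ι (φ i))) (φ n : H) with hcdef
  -- `g` dominates the coefficients of the vectors Bφ_i and is square summable by Parseval.
  set g : ℕ → ℝ := fun n => ∑ i, |c n i| with hg
  have hgs : Summable fun n => g n ^ 2 := by
    refine summable_sq_sum _ fun i => ?_
    refine (summable_sq_inner b (B (ι (φ i)))).congr fun n => ?_
    rw [hb, real_inner_comm]
  set S := ∑' n, g n ^ 2 with hS
  have hS0 : 0 ≤ S := tsum_nonneg fun n => sq_nonneg _
  -- The root bounds the solution, `K` the control, and 1 ensures positivity.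
  set C := Real.sqrt (K₁ * (1 + S * K ^ 2)) + K + 1 with hC
  have hC0 : 0 < C := by positivity
  refine ⟨C, hC0, fun f fe ye hf y₀ => ?_⟩
  set x := y₀ - (ye : H) with hx
  have hxn : ∀ n, |inner ℝ (b n) x| ≤ ‖x‖ := fun n => by
    simpa [b.orthonormal.1 n] using abs_real_inner_le_norm (b n) x
  obtain ⟨v, hv1, hv2, hv3, hv4⟩ := hctrl (fun n => inner ℝ (b n) x) ‖x‖ (fun n => hxn n)
  have hexp : ∀ t ≥ (0 : ℝ), Real.exp (-(γ + 1) * t) ≤ Real.exp (-γ * t) := fun t ht =>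
    Real.exp_le_exp.mpr (by nlinarith)
  have hvb : ∀ i, ∀ t ≥ 0, |v i t| ≤ K * Real.exp (-(γ + 1) * t) * ‖x‖ := fun i t ht => by
    have := hv4 i t ht
    linarith [abs_nonneg (deriv (v i) t), abs_nonneg (deriv (deriv (v i)) t)]
  refine ⟨v, ⟨hf.exists_absorbs _, fun ut hut => ?_⟩, hv1, hv2, fun i t ht => ?_⟩
  · have hvc : ∀ i, Continuous (v i) := fun i => (hv1 i).continuous
    set F : ℝ → H := fun t => B (finiteControl ι φ v t) with hF
    have hFc : Continuous F := by
      simp only [hF, finiteControl]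
      fun_prop
    have hFn : ∀ n t, inner ℝ (b n) (F t) = ∑ i, c n i * v i t := by
      intro n t
      simp only [hF, finiteControl, map_sum, map_smul, inner_sum, inner_smul_right, hb, hcdef]
      refine Finset.sum_congr rfl fun i _ => ?_
      rw [real_inner_comm, mul_comm]
    have hFb : ∀ n, ∀ t ≥ 0, |inner ℝ (b n) (F t)| ≤
        g n * (K * ‖x‖) * Real.exp (-(γ + 1) * t) := by
      intro n t ht
      rw [hFn]
      refine (Finset.abs_sum_le_sum_abs _ _).trans ?_
      rw [hg, Finset.sum_mul, Finset.sum_mul]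
      refine Finset.sum_le_sum fun i _ => ?_
      rw [abs_mul]
      calc _ ≤ |c n i| * (K * Real.exp (-(γ + 1) * t) * ‖x‖) := by
            gcongr; exact hvb i t ht
        _ = _ := by ring
    have hg0 : ∀ n, 0 ≤ g n := fun n => Finset.sum_nonneg fun i _ => abs_nonneg _
    have hG : Summable fun n => (g n * (K * ‖x‖)) ^ 2 := by
      simpa [mul_comm] using summable_sq_const_mul (K * ‖x‖) hgs
    have hFG : ∀ n, ∀ t ≥ 0, |inner ℝ (b n) (F t)| ≤ g n * (K * ‖x‖) := fun n t ht =>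
      (hFb n t ht).trans (mul_le_of_le_one_right (mul_nonneg (hg0 n) (by positivity))
        (Real.exp_le_one_iff.mpr (by nlinarith)))
    have hR : ∀ t ≥ 0, F t = translatedRHS A B δ f fe ye ut t := fun t ht =>
      (hf.translatedRHS_eq hδ hut ht).symm
    refine ⟨modalSolution lam b δ F x,
      (isSolution_modalSolution hA hφ hb hδ hFc hG hFG x).congr hR, fun z hz => ?_,
      fun hy₀ => (isClassicalSolution_modalSolution hA hφ hb hδ hFc hG hFG
        (A.domain.sub_mem hy₀ ye.2)).congr hR, fun t ht => ?_⟩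
    · exact (hz.congr fun t ht => (hR t ht).symm).eqOn_modalSolution hA hφ hb hδ hFc hG hFG
    · have hY : ∀ n, inner ℝ (b n) (modalSolution lam b δ F x t) ^ 2 ≤
          K₁ * Real.exp (-γ * t) ^ 2 * (inner ℝ (b n) x ^ 2 + (g n * (K * ‖x‖)) ^ 2) := by
        intro n
        rw [inner_modalSolution hlam hδ hFc hG hFG x ht]
        refine hdecay n _ _ _ _ _ (isMode_inner b δ hFc x (lam n) n) (hFb n) (fun hn s hs => ?_)
          t ht
        have h0 := modeSol_eq_zero (δ := δ) (l := lam n) (x := inner ℝ (b n) x) (T := T)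
          (h := fun t => inner ℝ (b n) (F t)) (continuous_const.inner hFc) (fun t ht => by
            rw [hFn]
            exact Finset.sum_eq_zero fun i _ => by rw [hv2 i t ht, mul_zero]) (by
            simp only [hFn]
            exact hv3 ⟨n, hn⟩) hs
        rw [h0]
        rfl
      have hsum := hasSum_le hY (hasSum_sq_inner b (modalSolution lam b δ F x t))
        (((hasSum_sq_inner b x).add hG.hasSum).mul_left _)
      have hGS : ∑' n, (g n * (K * ‖x‖)) ^ 2 = S * (K * ‖x‖) ^ 2 := by
        rw [hS, ← tsum_mul_right]
        exact tsum_congr fun n => by ring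
      rw [hGS] at hsum
      have h1 : ‖modalSolution lam b δ F x t‖ ≤
          Real.sqrt (K₁ * (1 + S * K ^ 2)) * Real.exp (-γ * t) * ‖x‖ := by
        refine (pow_le_pow_iff_left₀ (norm_nonneg _) (by positivity) two_ne_zero).mp ?_
        rw [mul_pow, mul_pow, Real.sq_sqrt (by positivity)]
        linarith
      refine h1.trans ?_
      gcongr
      rw [hC]
      linarith
  · refine (hv4 i t ht).trans ?_
    have h1 : K ≤ C := by
      rw [hC]
      linarith [Real.sqrt_nonneg (K₁ * (1 + S * K ^ 2))]
    have h2 := hexp t ht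
    gcongr

/-- A function that vanishes after `T` is a convolution of `v' + δ v` with the kernel. -/
theorem eq_neg_integral_beta {v : ℝ → ℝ} (hv : ContDiff ℝ 2 v) {T : ℝ} (h0 : v T = 0) (t : ℝ) :
    v t = -∫ s in t..T, beta δ (t - s) * (deriv v s + δ * v s) := by
  have h1 : Continuous (deriv v) := (contDiff_one_deriv hv).continuous
  have h2 := hv.continuous
  have h3 := continuous_beta δ
  have hd : ∀ s ∈ uIcc t T, HasDerivAt (fun s => beta δ (t - s) * v s)
      (beta δ (t - s) * (deriv v s + δ * v s)) s := by
    intro s _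
    have h4 := (hasDerivAt_beta δ (t - s)).comp s ((hasDerivAt_id s).const_sub t)
    have h5 := (hv.differentiable (by norm_num) s).hasDerivAt
    exact (h4.mul h5).congr_deriv (by simp only [Function.comp]; ring)
  rw [intervalIntegral.integral_eq_sub_of_hasDerivAt hd
    (Continuous.intervalIntegrable (by fun_prop) _ _), h0, sub_self, beta_zero]
  ring

end Stabilization

end PIDE

theorem mainTheorem6 {H U : Type*}
    [NormedAddCommGroup H] [InnerProductSpace ℝ H] [CompleteSpace H]
    [NormedAddCommGroup U] [InnerProductSpace ℝ U] [CompleteSpace U]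
    (A : H →ₗ.[ℝ] H) (hA : PIDE.IsAdmissibleOperator A)
    (φ : ℕ → A.domain) (lam : ℕ → ℝ) (hφ : PIDE.IsEigenbasis A φ lam)
    (B : U →L[ℝ] H) (ι : A.domain →ₗ[ℝ] U)
    (δ γ : ℝ) (hδ : 0 < δ) (hγ : 0 < γ) (hγδ : γ < 1 + δ)
    (N M : ℕ) (hN : N = PIDE.numUnstable δ γ lam) (hM : M = PIDE.maxMult lam N)
    (hrank : PIDE.SemisimpleRank A B ι φ lam δ N M ∨ PIDE.JordanRank A B ι φ lam δ N M) :
    (∀ T > 0, ∃ C > 0, ∀ (f : ℝ → H) (fe : H) (ye : A.domain), PIDE.IsForcing A B δ f fe ye →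
      ∀ y₀ : H, ∃ v w : Fin M → ℝ → ℝ,
        PIDE.Stabilizes A B δ γ C f fe ye y₀ (PIDE.finiteControl ι φ v) ∧
        (∀ i, ContinuousOn (v i) (Ici 0)) ∧
        (∀ i, ContinuousOn (w i) (Icc 0 T)) ∧
        (∀ i, ∀ t ∈ Ico 0 T, v i t = -∫ s in t..T, PIDE.beta δ (t - s) * w i s) ∧
        (∀ i, ∀ t ≥ T, v i t = 0 ∧ w i t = 0) ∧
        ∫ t in (0 : ℝ)..T, ∑ i, |w i t| ^ 2 ≤ C * ‖y₀ - ye‖ ^ 2) ∧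
    (∃ C > 0, ∀ (f : ℝ → H) (fe : H) (ye : A.domain), PIDE.IsForcing A B δ f fe ye →
      ∀ y₀ : H, ∃ v : Fin M → ℝ → ℝ,
        PIDE.Stabilizes A B δ γ C f fe ye y₀ (PIDE.finiteControl ι φ v) ∧
        (∀ j, ContDiffOn ℝ 2 (v j) (Ici 0)) ∧
        ∀ j, ∀ t > 0, |v j t| + |deriv (v j) t| + |deriv (deriv (v j)) t| ≤
          C * Real.exp (-γ * t) * ‖y₀ - ye‖) := by
  have hc := (hrank.elim PIDE.SemisimpleRank.jordanRank id).rowsIndep hδ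
  refine ⟨fun T hT => ?_, ?_⟩
  · obtain ⟨C, hC, h⟩ := PIDE.exists_stabilizing_control hA hφ hδ hγ hγδ hN hc hT
    -- The second summand bounds the integral over [0, T] of M terms, each at most ((1 + δ)C|y₀ -
    -- y_e|)².
    refine ⟨C + T * (M * ((1 + δ) * C) ^ 2), by positivity, fun f fe ye hf y₀ => ?_⟩
    obtain ⟨v, hv, hv1, hv2, hv3⟩ := h f fe ye hf y₀
    have hwc : ∀ i, Continuous fun t => deriv (v i) t + δ * v i t := fun i =>
      (PIDE.contDiff_one_deriv (hv1 i)).continuous.add (continuous_const.mul (hv1 i).continuous)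
    refine ⟨v, fun i t => deriv (v i) t + δ * v i t,
      hv.mono (le_add_of_nonneg_right (by positivity)),
      fun i => (hv1 i).continuous.continuousOn, fun i => (hwc i).continuousOn,
      fun i t _ => PIDE.eq_neg_integral_beta (hv1 i) (hv2 i T le_rfl) t,
      fun i t ht => ⟨hv2 i t ht, ?_⟩, ?_⟩
    · simp only [PIDE.deriv_eq_zero_of_vanish ((hv1 i).differentiable (by norm_num)) (hv2 i) ht,
        hv2 i t ht, mul_zero, add_zero]
    · have hw : ∀ i, ∀ t ≥ 0, |deriv (v i) t + δ * v i t| ≤ (1 + δ) * C * ‖y₀ - ye‖ := by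
        intro i t ht
        have h1 := hv3 i t ht
        have h2 : C * Real.exp (-γ * t) * ‖y₀ - ye‖ ≤ C * 1 * ‖y₀ - ye‖ := by
          gcongr
          exact Real.exp_le_one_iff.mpr (by nlinarith)
        have h3 := abs_add_le (deriv (v i) t) (δ * v i t)
        rw [abs_mul, abs_of_pos hδ] at h3
        have h4 := abs_nonneg (deriv (deriv (v i)) t)
        have h5 : |v i t| + |deriv (v i) t| ≤ C * ‖y₀ - ye‖ := by linarith
        nlinarith [abs_nonneg (v i t), abs_nonneg (deriv (v i) t)]
      have hint : ∫ t in (0 : ℝ)..T, ∑ i, |deriv (v i) t + δ * v i t| ^ 2 ≤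
          ∫ _ in (0 : ℝ)..T, (M * ((1 + δ) * C) ^ 2 * ‖y₀ - ye‖ ^ 2 : ℝ) := by
        refine intervalIntegral.integral_mono_on hT.le
          (Continuous.intervalIntegrable (by fun_prop) _ _)
          (Continuous.intervalIntegrable (by fun_prop) _ _) fun t ht => ?_
        refine (Finset.sum_le_sum (g := fun _ => ((1 + δ) * C * ‖y₀ - ye‖) ^ 2) fun i _ =>
          pow_le_pow_left₀ (abs_nonneg _) (hw i t ht.1) 2).trans_eq ?_
        simp
        ring
      refine hint.trans ?_
      rw [intervalIntegral.integral_const, smul_eq_mul, sub_zero]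
      nlinarith [sq_nonneg ‖y₀ - (ye : H)‖]
  -- Any horizon would do here; T = 1 is chosen.
  · obtain ⟨C, hC, h⟩ := PIDE.exists_stabilizing_control hA hφ hδ hγ hγδ hN hc one_pos
    refine ⟨C, hC, fun f fe ye hf y₀ => ?_⟩
    obtain ⟨v, hv, hv1, -, hv3⟩ := h f fe ye hf y₀
    exact ⟨v, hv, fun j => (hv1 j).contDiffOn, fun j t ht => hv3 j t ht.le⟩
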